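/- Theorem (push-pull protocol with transition time). Let $n \ge 2$ and consider rumor spreading on the complete graph with $n$ nodes in synchronous rounds $1, 2, 3, \dots$. At the start exactly one node is informed. In each round every node of a certain set of calling nodes calls one node chosen independently and uniformly at random from all $n$ nodes (possibly itself). Each node that receives at least one call accepts exactly one of its incoming calls of this round, chosen uniformly at random among them and independently of the other nodes' choices; all other calls are dropped. If an accepted call has at least one end that was informed at the start of the round, then both its ends are informed at the end of the round; informed nodes stay informed. In the single incoming call push-pull protocol with transition time $R$, all nodes call in rounds $1, \dots, R$, and in each round after round $R$ exactly the nodes that are uninformed at the start of the round call. Let $T$ be its rumor spreading time, that is, the smallest $t \ge 0$ such that all $n$ nodes are informed after $t$ rounds. For the transition time $R = \lceil \log_{3-2/e} n \rceil$, the expected rumor spreading time is finite and satisfies \[ \mathbb{E}[T] = \log_{3-2/e} n + \log_2 \ln n \pm O(1), \] that is, there is an absolute constant $C$ such that $\left| \mathbb{E}[T] - \left(\log_{3-2/e} n + \log_2 \ln n\right) \right| \le C$ for all $n \ge 2$ and every initially informed node. -/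

import Mathlib

open scoped ENNReal
open MeasureTheory ProbabilityTheory

namespace RumorSpreading

noncomputable section

variable {n : ℕ}

/-- The nodes whose call, under the call vector `c`, reaches the node `y` in a round in which
exactly the nodes of `A` call. -/
def incoming (A : Finset (Fin n)) (c : Fin n → Fin n) (y : Fin n) : Finset (Fin n) :=
  {x ∈ A | c x = y}

/-- What the node `y` can do with its incoming calls: if there is none, it accepts nothing
(`none`); otherwise it accepts exactly one of them (`some x` is the call made by `x`). -/
def acceptOptions (A : Finset (Fin n)) (c : Fin n → Fin n) (y : Fin n) :
    Finset (Option (Fin n)) :=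
  if (incoming A c y).Nonempty then (incoming A c y).map Function.Embedding.some else {none}

theorem acceptOptions_nonempty (A : Finset (Fin n)) (c : Fin n → Fin n) (y : Fin n) :
    (acceptOptions A c y).Nonempty := by
  unfold acceptOptions
  split_ifs with h
  · exact h.map
  · exact Finset.singleton_nonempty none

/-- The informed nodes at the end of a round that starts with the set `I` of informed nodes, when
`a y` is the call accepted by the node `y`. The rumor is transmitted, in either direction, through
every accepted call one of whose two ends is in `I`; all other calls are dropped. -/
def exchange (I : Finset (Fin n)) (a : Fin n → Option (Fin n)) : Finset (Fin n) :=
  {z | z ∈ I ∨ ∃ x y, a y = some x ∧ (x ∈ I ∨ y ∈ I) ∧ (z = x ∨ z = y)}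

/-- The law of the set of informed nodes after one round of the single incoming call model that
starts with the set `I` of informed nodes and in which the nodes of `A` call: the callers choose
independent uniform targets among all `n` nodes, and then each called node accepts one of its
incoming calls, uniformly at random and independently of the other nodes. -/
def roundLaw (A I : Finset (Fin n)) : PMF (Finset (Fin n)) :=
  (PMF.uniformOfFinset (Finset.univ : Finset (Fin n → Fin n)) ⟨id, Finset.mem_univ _⟩).bind
    fun c => (PMF.uniformOfFinset (Fintype.piFinset (acceptOptions A c))
      (Fintype.piFinset_nonempty.2 (acceptOptions_nonempty A c))).map (exchange I)

/-- The nodes that call in round `t + 1` of the push-pull protocol with transition time `R`, when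
`I` is informed after `t` rounds: all nodes in the first `R` rounds (push and pull calls), only the
uninformed nodes in all later rounds (pull calls only). -/
def callers (R t : ℕ) (I : Finset (Fin n)) : Finset (Fin n) :=
  if t < R then Finset.univ else Iᶜ

/-- The transition kernel of round `t + 1`, from the history `I₀, …, I_t` to `I_{t+1}`. -/
def stepKernel (n R t : ℕ) :
    Kernel ((i : Finset.Iic t) → (fun _ : ℕ => Finset (Fin n)) i) (Finset (Fin n)) where
  toFun h := (roundLaw (callers R t (h ⟨t, Finset.mem_Iic.2 le_rfl⟩))
    (h ⟨t, Finset.mem_Iic.2 le_rfl⟩)).toMeasure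
  measurable' := measurable_of_countable _

instance (n R t : ℕ) : IsMarkovKernel (stepKernel n R t) :=
  ⟨fun h => by dsimp [stepKernel]; infer_instance⟩

/-- The law of the whole process `(I_t)` of sets of informed nodes of the single incoming call
push-pull protocol with transition time `R` on `n` nodes, started with `I₀ = {v}`. -/
def protocolLaw (n R : ℕ) (v : Fin n) : Measure (ℕ → Finset (Fin n)) :=
  Kernel.traj (X := fun _ : ℕ => Finset (Fin n)) (stepKernel n R) 0 (fun _ => {v})

/-- The rumor spreading time: the first `t` such that all `n` nodes are informed after `t` rounds
(`⊤` if there is none). -/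
def spreadingTime (I : ℕ → Finset (Fin n)) : ℕ∞ :=
  ⨅ (t : ℕ) (_ : I t = Finset.univ), (t : ℕ∞)

/-- The expected rumor spreading time. -/
def expectedSpreadingTime (n R : ℕ) (v : Fin n) : ℝ≥0∞ :=
  ∫⁻ I, (spreadingTime I : ℝ≥0∞) ∂(protocolLaw n R v)

end

end RumorSpreading

namespace RumorSpreading

noncomputable section

/-! Full information is absorbing, so `E[T]` is the sum over `t` of the probability that some node
is still uninformed after `t` rounds. Only the one-time laws `informedLaw` matter, and each of the
two phases is summed separately with the help of potential functions.

The law of accepted calls is accessible because the nodes of a set `S` are all idle with probability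
exactly `(1 - |S|/n)^|A|`, and because, when all nodes call, renaming the callers changes nothing.
Averaging over callers turns acceptance and rejection probabilities into idleness probabilities
(`ev_accepts_mul_le`, `ev_idle_mul_rejected`). First and second moments suffice throughout.

Push-pull phase, with `k` nodes informed: the mean grows by a factor of at most `growth + O(1/n)`,
so by Markov's inequality and a geometric sum all but `O(1)` of the first `R` rounds count in full
(`le_sum_unfinishedProb_push`). Conversely, `log k` gains `log growth - O(1/k + k/n)` in expectation
(`le_ev_log_card_pushPull`). These errors are summable, hence `log (n/k)` has bounded mean at the
transition. Nor is the phase too successful: the truncated `deficit` of the uninformed count also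
has bounded mean at the transition (`ev_deficit_pushPull_le`), since linearly many uninformed nodes
take part in no accepted call.

Pull phase, with `u` nodes uninformed: a round takes `u` to about `u^2/n` up to a constant factor,
so `log (n/u)` roughly doubles and about `log_2 ln n` rounds are needed. For the upper bound,
`pullTime` drops by at least one in expectation per unfinished round (`ev_pullTime_le`). For the
lower bound, `levelCount` rises by at most `1 + o(1)` per unfinished round
(`ev_levelCount_pull_le`), starts with bounded mean and must reach `maxLevel n`, which is at least
`log_2 ln n - 2`. Stopping this count at `n^(3/4)` uninformed nodes keeps Chebyshev's inequality
effective. -/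

/-- Expectation of a real function under a probability mass function on a finite type. -/
def ev {α : Type*} [Fintype α] (p : PMF α) (f : α → ℝ) : ℝ := ∑ a, (p a).toReal * f a

/-! ### Expectations on finite probability spaces. -/

section ev

variable {α β : Type*} [Fintype α] [Fintype β]

theorem sum_toReal (p : PMF α) : ∑ a, (p a).toReal = 1 := by
  rw [← ENNReal.toReal_sum (fun a _ => p.apply_ne_top a), ← tsum_fintype (L := .unconditional α),
    p.tsum_coe, ENNReal.toReal_one]

theorem ev_const (p : PMF α) (c : ℝ) : ev p (fun _ => c) = c := by
  rw [ev, ← Finset.sum_mul, sum_toReal, one_mul]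

theorem ev_add (p : PMF α) (f g : α → ℝ) : ev p (fun a => f a + g a) = ev p f + ev p g := by
  simp [ev, mul_add, Finset.sum_add_distrib]

theorem ev_sub (p : PMF α) (f g : α → ℝ) : ev p (fun a => f a - g a) = ev p f - ev p g := by
  simp [ev, mul_sub, Finset.sum_sub_distrib]

theorem ev_mul (p : PMF α) (c : ℝ) (f : α → ℝ) : ev p (fun a => c * f a) = c * ev p f := by
  simp only [ev, Finset.mul_sum]
  exact Finset.sum_congr rfl fun a _ => by ring

theorem ev_div (p : PMF α) (f : α → ℝ) (c : ℝ) : ev p (fun a => f a / c) = ev p f / c := by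
  simp only [ev, Finset.sum_div]
  exact Finset.sum_congr rfl fun a _ => by ring

theorem ev_sum {ι : Type*} (p : PMF α) (s : Finset ι) (f : ι → α → ℝ) :
    ev p (fun a => ∑ i ∈ s, f i a) = ∑ i ∈ s, ev p (f i) := by
  simp only [ev, Finset.mul_sum]
  exact Finset.sum_comm

theorem ev_mono_support (p : PMF α) {f g : α → ℝ} (h : ∀ a ∈ p.support, f a ≤ g a) :
    ev p f ≤ ev p g := by
  refine Finset.sum_le_sum fun a _ => ?_
  by_cases ha : a ∈ p.support
  · exact mul_le_mul_of_nonneg_left (h a ha) ENNReal.toReal_nonneg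
  · rw [(p.apply_eq_zero_iff a).2 ha]; simp

theorem ev_mono (p : PMF α) {f g : α → ℝ} (h : ∀ a, f a ≤ g a) : ev p f ≤ ev p g :=
  ev_mono_support p fun a _ => h a

theorem ev_congr_support (p : PMF α) {f g : α → ℝ} (h : ∀ a ∈ p.support, f a = g a) :
    ev p f = ev p g :=
  le_antisymm (ev_mono_support p fun a ha => (h a ha).le)
    (ev_mono_support p fun a ha => (h a ha).ge)

theorem ev_nonneg (p : PMF α) {f : α → ℝ} (h : ∀ a, 0 ≤ f a) : 0 ≤ ev p f :=
  Finset.sum_nonneg fun a _ => mul_nonneg ENNReal.toReal_nonneg (h a)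

theorem ev_pure [DecidableEq α] (a : α) (f : α → ℝ) : ev (PMF.pure a) f = f a := by
  rw [ev, Finset.sum_eq_single a] <;> simp +contextual [PMF.pure_apply]

theorem ev_bind (p : PMF α) (q : α → PMF β) (f : β → ℝ) :
    ev (p.bind q) f = ev p fun a => ev (q a) f := by
  simp only [ev, PMF.bind_apply, tsum_fintype]
  have h : ∀ b, (∑ a, p a * q a b).toReal = ∑ a, (p a).toReal * (q a b).toReal := fun b => by
    rw [ENNReal.toReal_sum fun a _ => ENNReal.mul_ne_top (p.apply_ne_top a) ((q a).apply_ne_top b)]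
    simp
  simp only [h, Finset.sum_mul, Finset.mul_sum]
  rw [Finset.sum_comm]
  exact Finset.sum_congr rfl fun a _ => Finset.sum_congr rfl fun b _ => by ring

theorem ev_map (p : PMF α) (g : α → β) (f : β → ℝ) : ev (p.map g) f = ev p fun a => f (g a) := by
  classical
  rw [PMF.map, ev_bind]
  simp [ev_pure]

theorem ev_uniformOfFinset (s : Finset α) (hs : s.Nonempty) (f : α → ℝ) :
    ev (PMF.uniformOfFinset s hs) f = (s.card : ℝ)⁻¹ * ∑ a ∈ s, f a := by
  classical
  rw [ev, Finset.mul_sum, ← Finset.sum_subset (Finset.subset_univ s)]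
  · exact Finset.sum_congr rfl fun a ha => by simp [PMF.uniformOfFinset_apply_of_mem hs ha]
  · intro a _ ha
    simp [PMF.uniformOfFinset_apply_of_notMem hs ha]

theorem lintegral_toMeasure [MeasurableSpace α] [MeasurableSingletonClass α] (p : PMF α)
    (f : α → ℝ≥0∞) : ∫⁻ a, f a ∂p.toMeasure = ∑ a, p a * f a := by
  rw [lintegral_fintype]
  exact Finset.sum_congr rfl fun a _ => by
    rw [PMF.toMeasure_apply_singleton _ _ (measurableSet_singleton a), mul_comm]

theorem lintegral_ofReal_toMeasure [MeasurableSpace α] [MeasurableSingletonClass α] (p : PMF α)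
    {f : α → ℝ} (hf : ∀ a, 0 ≤ f a) :
    ∫⁻ a, ENNReal.ofReal (f a) ∂p.toMeasure = ENNReal.ofReal (ev p f) := by
  rw [lintegral_toMeasure, ev, ENNReal.ofReal_sum_of_nonneg
    fun a _ => mul_nonneg ENNReal.toReal_nonneg (hf a)]
  exact Finset.sum_congr rfl fun a _ => by
    rw [ENNReal.ofReal_mul ENNReal.toReal_nonneg, ENNReal.ofReal_toReal (p.apply_ne_top a)]

end ev

/-! ### From the trajectory measure to one-time laws. -/

/-- The law of the set of informed nodes after `t` rounds. -/
def informedLaw (n R : ℕ) (v : Fin n) : ℕ → PMF (Finset (Fin n))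
  | 0 => PMF.pure {v}
  | t + 1 => (informedLaw n R v t).bind fun I => roundLaw (callers R t I) I

instance (n R : ℕ) (v : Fin n) : IsProbabilityMeasure (protocolLaw n R v) := by
  unfold protocolLaw; infer_instance

/-- The Markov property: the joint law of the history up to `t` and the next state is the
composition product of the partial trajectory with `stepKernel`, which reads only the last state. -/
theorem lintegral_step {n R : ℕ} (v : Fin n) (t : ℕ)
    (g : Finset (Fin n) → Finset (Fin n) → ℝ≥0∞) :
    ∫⁻ I, g (I t) (I (t + 1)) ∂protocolLaw n R v =
      ∫⁻ I, (∫⁻ S, g (I t) S ∂(roundLaw (callers R t (I t)) (I t)).toMeasure)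
        ∂protocolLaw n R v := by
  have hmeas : Measurable fun z : ((i : Finset.Iic t) → (fun _ : ℕ => Finset (Fin n)) i) ×
      Finset (Fin n) => g (z.1 ⟨t, Finset.mem_Iic.2 le_rfl⟩) z.2 := measurable_of_countable _
  have h1 := Kernel.partialTraj_compProd_eq_map_traj (X := fun _ : ℕ => Finset (Fin n))
    (κ := stepKernel n R) (a := 0) (b := t) (Nat.zero_le t) (x₀ := fun _ => {v})
  have h2 := Kernel.traj_map_frestrictLe_apply (X := fun _ : ℕ => Finset (Fin n))
    (κ := stepKernel n R) 0 t (fun _ => {v})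
  have h3 := lintegral_map (μ := protocolLaw n R v) hmeas
    (g := fun x => (Preorder.frestrictLe t x, x (t + 1))) (by fun_prop)
  have h4 : ∫⁻ I, g (I t) (I (t + 1)) ∂protocolLaw n R v = ∫⁻ z, g
      (z.1 ⟨t, Finset.mem_Iic.2 le_rfl⟩) z.2 ∂((protocolLaw n R v).map
        fun x => (Preorder.frestrictLe t x, x (t + 1))) := h3.symm
  rw [h4, protocolLaw, ← h1, Measure.lintegral_compProd hmeas, ← h2,
    lintegral_map (measurable_of_countable _) (by fun_prop)]
  rfl

theorem map_eval_protocolLaw {n R : ℕ} (v : Fin n) (t : ℕ) :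
    (protocolLaw n R v).map (fun I => I t) = (informedLaw n R v t).toMeasure := by
  induction t with
  | zero =>
    have h2 := Kernel.traj_map_frestrictLe_apply (X := fun _ : ℕ => Finset (Fin n))
      (κ := stepKernel n R) 0 0 (fun _ => {v})
    rw [Kernel.partialTraj_self, Kernel.id_apply] at h2
    have h3 := congrArg (Measure.map fun x => x ⟨0, Finset.mem_Iic.2 le_rfl⟩) h2
    rw [Measure.map_map (by fun_prop) (by fun_prop)] at h3
    rw [informedLaw, PMF.toMeasure_pure]
    exact h3.trans (Measure.map_dirac' (measurable_of_countable _) _)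
  | succ t ih =>
    ext s hs
    have h1 := lintegral_step (R := R) v t fun _ S => s.indicator 1 S
    have h2 : ∫⁻ I : ℕ → Finset (Fin n), s.indicator 1 (I (t + 1)) ∂protocolLaw n R v =
        (protocolLaw n R v).map (fun I => I (t + 1)) s := by
      rw [← lintegral_indicator_one hs, lintegral_map (measurable_of_countable _) (by fun_prop)]
    have h3 := lintegral_map (μ := protocolLaw n R v) (g := fun I => I t)
      (f := fun J => ∫⁻ S, s.indicator 1 S ∂(roundLaw (callers R t J) J).toMeasure)
      (measurable_of_countable _) (by fun_prop)
    rw [← h2, h1, ← h3, ih, lintegral_toMeasure, informedLaw, PMF.toMeasure_bind_apply _ _ _ hs,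
      tsum_fintype]
    exact Finset.sum_congr rfl fun J _ => by rw [lintegral_indicator_one hs]

theorem subset_of_mem_support_roundLaw {n : ℕ} {A I S : Finset (Fin n)}
    (h : S ∈ (roundLaw A I).support) : I ⊆ S := by
  unfold roundLaw at h
  simp only [PMF.mem_support_bind_iff, PMF.mem_support_map_iff] at h
  obtain ⟨c, -, a, -, rfl⟩ := h
  intro z hz
  simp [exchange, hz]

/-- The path space contains non-monotone sequences, so absorption holds only almost surely. -/
theorem ae_eq_univ_succ {n R : ℕ} (v : Fin n) :
    ∀ᵐ I ∂protocolLaw n R v, ∀ t, I t = Finset.univ → I (t + 1) = Finset.univ := by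
  rw [ae_all_iff]
  intro t
  have h1 := lintegral_step (R := R) v t
    fun J S => if J = Finset.univ ∧ S ≠ Finset.univ then 1 else 0
  have h2 : ∀ J : Finset (Fin n), ∫⁻ S, (if J = Finset.univ ∧ S ≠ Finset.univ then 1 else 0 : ℝ≥0∞)
      ∂(roundLaw (callers R t J) J).toMeasure = 0 := by
    intro J
    rw [lintegral_toMeasure, Finset.sum_eq_zero]
    intro S _
    by_cases hS : S ∈ (roundLaw (callers R t J) J).support
    · rw [if_neg, mul_zero]
      rintro ⟨rfl, h⟩
      exact h (Finset.univ_subset_iff.1 (subset_of_mem_support_roundLaw hS))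
    · rw [(PMF.apply_eq_zero_iff _ _).2 hS, zero_mul]
  simp only [h2, lintegral_zero] at h1
  have hm : Measurable fun I : ℕ → Finset (Fin n) =>
      (if I t = Finset.univ ∧ I (t + 1) ≠ Finset.univ then 1 else 0 : ℝ≥0∞) :=
    (measurable_of_countable fun z : Finset (Fin n) × Finset (Fin n) =>
      (if z.1 = Finset.univ ∧ z.2 ≠ Finset.univ then 1 else 0 : ℝ≥0∞)).comp
      (g := fun z : Finset (Fin n) × Finset (Fin n) =>
      (if z.1 = Finset.univ ∧ z.2 ≠ Finset.univ then 1 else 0 : ℝ≥0∞))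
      (f := fun I : ℕ → Finset (Fin n) => (I t, I (t + 1))) (by fun_prop)
  rw [lintegral_eq_zero_iff hm] at h1
  filter_upwards [h1] with I hI h
  by_contra h'
  simp [h, h'] at hI

/-- By absorption the unfinished times are exactly those before the hitting time; if it is infinite,
both sides are `⊤`. -/
theorem spreadingTime_eq_tsum {n : ℕ} {I : ℕ → Finset (Fin n)}
    (hI : ∀ t, I t = Finset.univ → I (t + 1) = Finset.univ) :
    (spreadingTime I : ℝ≥0∞) = ∑' t, if I t = Finset.univ then 0 else 1 := by
  classical
  by_cases h : ∃ t, I t = Finset.univ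
  · have hle : ∀ t, I t = Finset.univ ↔ Nat.find h ≤ t := fun t =>
      ⟨fun ht => Nat.find_min' h ht, fun ht => by
        induction t, ht using Nat.le_induction with
        | base => exact Nat.find_spec h
        | succ t _ ih => exact hI t ih⟩
    have hT : spreadingTime I = (Nat.find h : ℕ∞) := by
      unfold spreadingTime
      refine le_antisymm (iInf₂_le (Nat.find h) (Nat.find_spec h)) (le_iInf₂ fun t ht => ?_)
      exact_mod_cast Nat.find_min' h ht
    rw [hT, tsum_eq_sum (s := Finset.range (Nat.find h))]
    · rw [Finset.sum_congr rfl (g := fun _ => (1 : ℝ≥0∞))]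
      · simp
      · intro t ht
        rw [if_neg]
        rw [hle]
        simpa using ht
    · intro t ht
      rw [if_pos]
      rw [hle]
      simpa using ht
  · push Not at h
    have hT : spreadingTime I = ⊤ := by
      unfold spreadingTime
      simp [h]
    simp [hT, h]

/-- The indicator that some node is still uninformed. -/
def unfinished {n : ℕ} (I : Finset (Fin n)) : ℝ := if I = Finset.univ then 0 else 1

theorem expectedSpreadingTime_eq_tsum {n R : ℕ} (v : Fin n) :
    expectedSpreadingTime n R v =
      ∑' t, ENNReal.ofReal (ev (informedLaw n R v t) unfinished) := by
  unfold expectedSpreadingTime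
  rw [lintegral_congr_ae ((ae_eq_univ_succ v).mono fun I hI => spreadingTime_eq_tsum hI),
    lintegral_tsum]
  · congr 1
    ext t
    rw [← lintegral_ofReal_toMeasure, ← map_eval_protocolLaw,
      lintegral_map (measurable_of_countable _) (by fun_prop)]
    · congr 1
      ext I
      unfold unfinished
      split_ifs <;> simp
    · intro I
      unfold unfinished
      split_ifs <;> simp
  · intro t
    exact ((measurable_of_countable fun J : Finset (Fin n) =>
      (if J = Finset.univ then 0 else 1 : ℝ≥0∞)).comp (measurable_pi_apply t)).aemeasurable


variable {n : ℕ}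

/-! ### The law of accepted calls and the exact probabilities of idleness. -/

theorem calls_nonempty : (Finset.univ : Finset (Fin n → Fin n)).Nonempty :=
  ⟨id, Finset.mem_univ _⟩

/-- The law of the accepted calls in a round in which the nodes of `A` call. -/
def acceptLaw (A : Finset (Fin n)) : PMF (Fin n → Option (Fin n)) :=
  (PMF.uniformOfFinset (Finset.univ : Finset (Fin n → Fin n)) calls_nonempty).bind
    fun c => PMF.uniformOfFinset (Fintype.piFinset (acceptOptions A c))
      (Fintype.piFinset_nonempty.2 (acceptOptions_nonempty A c))

/-- Once the callers are fixed, the accepted calls do not depend on who is informed, so `I` enters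
only through the deterministic map `exchange`. -/
theorem ev_roundLaw (A I : Finset (Fin n)) (f : Finset (Fin n) → ℝ) :
    ev (roundLaw A I) f = ev (acceptLaw A) fun a => f (exchange I a) := by
  have h : roundLaw A I = (acceptLaw A).map (exchange I) := by
    rw [acceptLaw, PMF.map_bind]
    rfl
  rw [h, ev_map]

theorem mem_acceptOptions_some {A : Finset (Fin n)} {c : Fin n → Fin n} {y x : Fin n} :
    some x ∈ acceptOptions A c y ↔ x ∈ A ∧ c x = y := by
  unfold acceptOptions
  split_ifs with h
  · simp [incoming]
  · rw [Finset.not_nonempty_iff_eq_empty] at h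
    have : x ∉ incoming A c y := by simp [h]
    simpa [incoming] using this

theorem mem_acceptOptions_none {A : Finset (Fin n)} {c : Fin n → Fin n} {y : Fin n} :
    none ∈ acceptOptions A c y ↔ ∀ x ∈ A, c x ≠ y := by
  unfold acceptOptions
  split_ifs with h
  · obtain ⟨x, hx⟩ := h
    simp only [incoming, Finset.mem_filter] at hx
    simp only [Finset.mem_map, Function.Embedding.some_apply, reduceCtorEq, and_false,
      exists_false, false_iff, not_forall]
    exact ⟨x, hx.1, fun h => h hx.2⟩
  · rw [Finset.not_nonempty_iff_eq_empty] at h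
    simp only [Finset.mem_singleton, true_iff]
    intro x hx hc
    have : x ∉ incoming A c y := by simp [h]
    exact this (by simp [incoming, hx, hc])

theorem exists_of_mem_support {A : Finset (Fin n)} {a : Fin n → Option (Fin n)}
    (h : a ∈ (acceptLaw A).support) : ∃ c : Fin n → Fin n, ∀ y, a y ∈ acceptOptions A c y := by
  unfold acceptLaw at h
  simp only [PMF.mem_support_bind_iff, PMF.mem_support_uniformOfFinset_iff,
    Fintype.mem_piFinset] at h
  obtain ⟨c, -, h⟩ := h
  exact ⟨c, h⟩

/-- Each caller has at most one accepted call. -/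
def IsInjAccept (a : Fin n → Option (Fin n)) : Prop :=
  ∀ ⦃x y z⦄, a y = some x → a z = some x → y = z

theorem isInjAccept_of_mem_support {A : Finset (Fin n)} {a : Fin n → Option (Fin n)}
    (h : a ∈ (acceptLaw A).support) : IsInjAccept a := by
  obtain ⟨c, hc⟩ := exists_of_mem_support h
  intro x y z hy hz
  have h1 := hc y
  have h2 := hc z
  rw [hy, mem_acceptOptions_some] at h1
  rw [hz, mem_acceptOptions_some] at h2
  rw [← h1.2, ← h2.2]

theorem mem_callers_of_mem_support {A : Finset (Fin n)} {a : Fin n → Option (Fin n)}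
    (h : a ∈ (acceptLaw A).support) {x y : Fin n} (hxy : a y = some x) : x ∈ A := by
  obtain ⟨c, hc⟩ := exists_of_mem_support h
  have h1 := hc y
  rw [hxy, mem_acceptOptions_some] at h1
  exact h1.1

/-- The indicator that `y` accepts nothing. -/
def idle (a : Fin n → Option (Fin n)) (y : Fin n) : ℝ := if a y = none then 1 else 0

/-- The indicator that `y` accepts the call of `x`. -/
def accepts (a : Fin n → Option (Fin n)) (y x : Fin n) : ℝ := if a y = some x then 1 else 0

/-- The indicator that no call of `x` is accepted. -/
def rejected (a : Fin n → Option (Fin n)) (x : Fin n) : ℝ := if ∃ y, a y = some x then 0 else 1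

/-- Idleness is decided by the call vector alone, whatever is accepted: all of `S` is idle iff every
caller's target avoids `S`, and the targets are independent. -/
theorem ev_prod_idle (A S : Finset (Fin n)) :
    ev (acceptLaw A) (fun a => ∏ y ∈ S, idle a y) = (1 - (S.card : ℝ) / n) ^ A.card := by
  have h1 : ∀ c : Fin n → Fin n, ev (PMF.uniformOfFinset (Fintype.piFinset (acceptOptions A c))
      (Fintype.piFinset_nonempty.2 (acceptOptions_nonempty A c))) (fun a => ∏ y ∈ S, idle a y) =
      if c ∈ Fintype.piFinset (fun x => if x ∈ A then Sᶜ else Finset.univ) then 1 else 0 := by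
    intro c
    refine (ev_congr_support _ fun a ha => ?_).trans (ev_const _ _)
    rw [PMF.mem_support_uniformOfFinset_iff, Fintype.mem_piFinset] at ha
    split_ifs with h
    · refine Finset.prod_eq_one fun y hy => ?_
      rw [idle, if_pos]
      cases hay : a y with
      | none => rfl
      | some x =>
        have h2 := ha y
        rw [hay, mem_acceptOptions_some] at h2
        have h3 := Fintype.mem_piFinset.1 h x
        rw [if_pos h2.1, h2.2, Finset.mem_compl] at h3
        exact absurd hy h3
    · rw [Fintype.mem_piFinset] at h
      push Not at h
      obtain ⟨x, hx⟩ := h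
      by_cases hxA : x ∈ A
      · rw [if_pos hxA, Finset.mem_compl, not_not] at hx
        refine Finset.prod_eq_zero hx ?_
        rw [idle, if_neg]
        intro h0
        have h2 := ha (c x)
        rw [h0, mem_acceptOptions_none] at h2
        exact h2 x hxA rfl
      · simp [hxA] at hx
  rw [acceptLaw, ev_bind]
  simp only [h1]
  rw [ev_uniformOfFinset, Finset.sum_ite_mem, Finset.univ_inter, Finset.sum_const, nsmul_eq_mul,
    mul_one, Fintype.card_piFinset, Finset.card_univ, Fintype.card_fun, Fintype.card_fin]
  have h2 : ∀ x : Fin n, ((if x ∈ A then Sᶜ else Finset.univ : Finset (Fin n)).card : ℝ) =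
      n * if x ∈ A then (1 - (S.card : ℝ) / n) else 1 := by
    intro x
    have hn : (n : ℝ) ≠ 0 := by
      have := x.pos
      positivity
    split_ifs
    · have h4 := Finset.card_compl_add_card S
      rw [Fintype.card_fin] at h4
      have h5 : ((Sᶜ.card : ℝ)) + S.card = n := by exact_mod_cast h4
      field_simp
      linarith
    · simp
  push_cast
  simp only [h2]
  rw [Finset.prod_mul_distrib, Finset.prod_const, Finset.card_univ, Fintype.card_fin,
    Finset.prod_ite_mem, Finset.univ_inter, Finset.prod_const]
  rcases Nat.eq_zero_or_pos n with rfl | hn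
  · simp
  · have : (n : ℝ) ^ n ≠ 0 := by positivity
    field_simp

/-! ### Symmetry under renaming the callers. -/

/-- Renaming the callers. -/
def relabel (σ : Equiv.Perm (Fin n)) (a : Fin n → Option (Fin n)) : Fin n → Option (Fin n) :=
  fun y => (a y).map σ

theorem relabel_eq_some {σ : Equiv.Perm (Fin n)} {a : Fin n → Option (Fin n)} {x y : Fin n} :
    relabel σ a y = some (σ x) ↔ a y = some x := by
  cases h : a y <;> simp [relabel, h]

theorem idle_relabel (σ : Equiv.Perm (Fin n)) (a : Fin n → Option (Fin n)) (y : Fin n) :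
    idle (relabel σ a) y = idle a y := by
  simp [idle, relabel]

theorem accepts_relabel (σ : Equiv.Perm (Fin n)) (a : Fin n → Option (Fin n)) (y x : Fin n) :
    accepts (relabel σ a) y (σ x) = accepts a y x := by
  simp [accepts, relabel_eq_some]

theorem rejected_relabel (σ : Equiv.Perm (Fin n)) (a : Fin n → Option (Fin n)) (x : Fin n) :
    rejected (relabel σ a) (σ x) = rejected a x := by
  simp [rejected, relabel_eq_some]

theorem relabel_mem_piFinset {σ : Equiv.Perm (Fin n)} {c : Fin n → Fin n}
    {a : Fin n → Option (Fin n)} (ha : a ∈ Fintype.piFinset (acceptOptions Finset.univ c)) :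
    relabel σ a ∈ Fintype.piFinset (acceptOptions Finset.univ (c ∘ σ.symm)) := by
  rw [Fintype.mem_piFinset] at ha ⊢
  intro y
  have h := ha y
  cases hay : a y with
  | none =>
    rw [hay, mem_acceptOptions_none] at h
    simp only [relabel, hay, Option.map_none]
    rw [mem_acceptOptions_none]
    exact fun x _ => h _ (Finset.mem_univ _)
  | some x =>
    rw [hay, mem_acceptOptions_some] at h
    simp only [relabel, hay, Option.map_some]
    rw [mem_acceptOptions_some]
    simpa using h

theorem relabel_symm_relabel (σ : Equiv.Perm (Fin n)) (a : Fin n → Option (Fin n)) :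
    relabel σ.symm (relabel σ a) = a := by
  funext y
  cases h : a y <;> simp [relabel, h]

theorem sum_piFinset_relabel (σ : Equiv.Perm (Fin n)) (c : Fin n → Fin n)
    (f : (Fin n → Option (Fin n)) → ℝ) :
    ∑ a ∈ Fintype.piFinset (acceptOptions Finset.univ c), f (relabel σ a) =
      ∑ a ∈ Fintype.piFinset (acceptOptions Finset.univ (c ∘ σ.symm)), f a := by
  refine Finset.sum_nbij' (relabel σ) (relabel σ.symm) (fun a ha => relabel_mem_piFinset ha)
    (fun a ha => ?_) (fun a _ => relabel_symm_relabel σ a)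
    (fun a _ => relabel_symm_relabel σ.symm a) fun a _ => rfl
  have := relabel_mem_piFinset (σ := σ.symm) ha
  simpa [Function.comp_def] using this

/-- Renaming permutes the uniform call vectors and matches the acceptance choices bijectively. All
nodes must call, since otherwise the set of callers would not be preserved. -/
theorem ev_relabel (σ : Equiv.Perm (Fin n)) (f : (Fin n → Option (Fin n)) → ℝ) :
    ev (acceptLaw Finset.univ) (fun a => f (relabel σ a)) = ev (acceptLaw Finset.univ) f := by
  rw [acceptLaw, ev_bind, ev_bind, ev_uniformOfFinset, ev_uniformOfFinset]
  congr 1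
  have h : ∀ c : Fin n → Fin n,
      ((Fintype.piFinset (acceptOptions Finset.univ c)).card : ℝ) =
        (Fintype.piFinset (acceptOptions Finset.univ (c ∘ σ.symm))).card := by
    intro c
    have := sum_piFinset_relabel σ c fun _ => 1
    simpa using this
  refine Finset.sum_nbij' (fun c => c ∘ σ.symm) (fun c => c ∘ σ) ?_ ?_ ?_ ?_ ?_
  · simp
  · simp
  · intro c _
    funext x
    simp
  · intro c _
    funext x
    simp
  · intro c _
    rw [ev_uniformOfFinset, ev_uniformOfFinset, sum_piFinset_relabel, h]

theorem exists_perm_pair {x x' z z' : Fin n} (hx : x ≠ x') (hz : z ≠ z') :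
    ∃ σ : Equiv.Perm (Fin n), σ x = z ∧ σ x' = z' := by
  -- The first swap moves `x` to `z`; the second moves the image of `x'` to `z'` without touching
  -- `z`.
  refine ⟨Equiv.swap (Equiv.swap x z x') z' * Equiv.swap x z, ?_, ?_⟩
  · rw [Equiv.Perm.mul_apply, Equiv.swap_apply_left, Equiv.swap_apply_of_ne_of_ne _ hz]
    intro h
    have h2 : Equiv.swap x z x = Equiv.swap x z x' := by rw [Equiv.swap_apply_left]; exact h
    exact hx ((Equiv.swap x z).injective h2)
  · rw [Equiv.Perm.mul_apply, Equiv.swap_apply_left]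

/-- The symmetric group is transitive, so an equivariant family has the same expectation at every
caller. Sums over all callers are often explicit even when single terms are not. -/
theorem ev_eq_average (F : Fin n → (Fin n → Option (Fin n)) → ℝ)
    (hF : ∀ (σ : Equiv.Perm (Fin n)) x a, F (σ x) (relabel σ a) = F x a) (x : Fin n) :
    ev (acceptLaw Finset.univ) (F x) =
      ev (acceptLaw Finset.univ) (fun a => ∑ z, F z a) / n := by
  have hn : (n : ℝ) ≠ 0 := by
    have := x.pos
    positivity
  have h : ∀ z, ev (acceptLaw Finset.univ) (F z) = ev (acceptLaw Finset.univ) (F x) := by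
    intro z
    rw [← ev_relabel (Equiv.swap x z)]
    congr 1
    funext a
    nth_rw 1 [← Equiv.swap_apply_left x z]
    rw [hF]
  rw [ev_sum, Finset.sum_congr rfl fun z _ => h z]
  simp [hn]

/-- The analogue for two callers, by double transitivity. -/
theorem ev_pair_eq_average (F : Fin n → Fin n → (Fin n → Option (Fin n)) → ℝ)
    (hF : ∀ (σ : Equiv.Perm (Fin n)) x x' a, F (σ x) (σ x') (relabel σ a) = F x x' a)
    {x x' : Fin n} (hx : x ≠ x') :
    ev (acceptLaw Finset.univ) (F x x') =
      ev (acceptLaw Finset.univ)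
        (fun a => ∑ z ∈ Finset.univ.offDiag, F z.1 z.2 a) / (n * (n - 1)) := by
  have h : ∀ z ∈ (Finset.univ : Finset (Fin n)).offDiag,
      ev (acceptLaw Finset.univ) (F z.1 z.2) = ev (acceptLaw Finset.univ) (F x x') := by
    intro z hz
    obtain ⟨σ, h1, h2⟩ := exists_perm_pair hx (Finset.mem_offDiag.1 hz).2.2
    rw [← ev_relabel σ]
    congr 1
    funext a
    rw [← h1, ← h2, hF]
  have hn : 2 ≤ n := by
    have := x.isLt
    have := x'.isLt
    by_contra h
    exact hx (Fin.ext (by omega))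
  have hn' : (2 : ℝ) ≤ n := by exact_mod_cast hn
  have hn1 : (n : ℝ) - 1 ≠ 0 := by linarith
  have hn2 : (n : ℝ) ≠ 0 := by linarith
  rw [ev_sum, Finset.sum_congr rfl h, Finset.sum_const, Finset.offDiag_card, nsmul_eq_mul,
    Finset.card_univ, Fintype.card_fin, Nat.cast_sub (Nat.le_mul_self n)]
  push_cast
  field_simp

/-! ### Counting newly informed nodes. -/

theorem accepts_nonneg (a : Fin n → Option (Fin n)) (y x : Fin n) : 0 ≤ accepts a y x := by
  unfold accepts; split_ifs <;> norm_num

theorem idle_nonneg (a : Fin n → Option (Fin n)) (y : Fin n) : 0 ≤ idle a y := by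
  unfold idle; split_ifs <;> norm_num

theorem idle_le_one (a : Fin n → Option (Fin n)) (y : Fin n) : idle a y ≤ 1 := by
  unfold idle; split_ifs <;> norm_num

theorem sum_accepts_callee (a : Fin n → Option (Fin n)) (y : Fin n) (X : Finset (Fin n)) :
    ∑ x ∈ X, accepts a y x = if ∃ x ∈ X, a y = some x then 1 else 0 := by
  split_ifs with h
  · obtain ⟨x, hx, hy⟩ := h
    rw [Finset.sum_eq_single_of_mem x hx]
    · simp [accepts, hy]
    · intro z _ hz
      simp [accepts, hy, hz.symm]
  · refine Finset.sum_eq_zero fun x hx => ?_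
    rw [accepts, if_neg]
    exact fun h' => h ⟨x, hx, h'⟩

theorem sum_accepts_caller {a : Fin n → Option (Fin n)} (ha : IsInjAccept a) (x : Fin n)
    (Y : Finset (Fin n)) :
    ∑ y ∈ Y, accepts a y x = if ∃ y ∈ Y, a y = some x then 1 else 0 := by
  split_ifs with h
  · obtain ⟨y, hy, hxy⟩ := h
    rw [Finset.sum_eq_single_of_mem y hy]
    · simp [accepts, hxy]
    · intro z _ hz
      rw [accepts, if_neg]
      exact fun h' => hz (ha h' hxy)
  · refine Finset.sum_eq_zero fun y hy => ?_
    rw [accepts, if_neg]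
    exact fun h' => h ⟨y, hy, h'⟩

theorem sum_univ_accepts (a : Fin n → Option (Fin n)) (y : Fin n) :
    ∑ x, accepts a y x = 1 - idle a y := by
  rw [sum_accepts_callee]
  cases h : a y <;> simp [idle, h]

theorem rejected_eq {a : Fin n → Option (Fin n)} (ha : IsInjAccept a) (x : Fin n) :
    rejected a x = 1 - ∑ y, accepts a y x := by
  rw [sum_accepts_caller ha, rejected]
  by_cases h : ∃ y, a y = some x <;> simp [h]

/-- Accepted calls match the non-idle nodes bijectively with the callers that are not rejected, so
both complements have the same size. -/
theorem sum_rejected {a : Fin n → Option (Fin n)} (ha : IsInjAccept a) :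
    ∑ x, rejected a x = ∑ y, idle a y := by
  have h1 : ∑ x, rejected a x = ∑ x, (1 - ∑ y, accepts a y x) :=
    Finset.sum_congr rfl fun x _ => rejected_eq ha x
  have h2 : ∀ y, idle a y = 1 - ∑ x, accepts a y x := fun y => by rw [sum_univ_accepts]; ring
  simp only [h2]
  rw [h1, Finset.sum_sub_distrib, Finset.sum_sub_distrib, Finset.sum_comm]

/-- The number of accepted calls from `X` to `Y`. -/
def acceptCount (Y X : Finset (Fin n)) (a : Fin n → Option (Fin n)) : ℝ :=
  ∑ y ∈ Y, ∑ x ∈ X, accepts a y x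

/-- The number of nodes outside `I` that both accept a call from `I` and have their own call
accepted by a node of `I`. -/
def overlap (I : Finset (Fin n)) (a : Fin n → Option (Fin n)) : ℝ :=
  ∑ z ∈ Iᶜ, (∑ x ∈ I, accepts a z x) * ∑ y ∈ I, accepts a y z

/-- Inclusion-exclusion over the two ways in which a node outside `I` learns the rumor: accepting a
call from `I` (push) and having its call accepted in `I` (pull). -/
theorem card_exchange {a : Fin n → Option (Fin n)} (ha : IsInjAccept a) (I : Finset (Fin n)) :
    ((exchange I a).card : ℝ) =
      I.card + acceptCount Iᶜ I a + acceptCount I Iᶜ a - overlap I a := by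
  have h1 : ((exchange I a).card : ℝ) = ∑ z, if z ∈ exchange I a then 1 else 0 := by simp
  have h2 : ∀ z, ∀ _ : z ∈ Iᶜ, (if z ∈ exchange I a then (1 : ℝ) else 0) =
      (∑ x ∈ I, accepts a z x) + (∑ y ∈ I, accepts a y z) -
        (∑ x ∈ I, accepts a z x) * ∑ y ∈ I, accepts a y z := by
    intro z hz
    rw [Finset.mem_compl] at hz
    rw [sum_accepts_callee, sum_accepts_caller ha]
    have h3 : z ∈ exchange I a ↔ (∃ x ∈ I, a z = some x) ∨ ∃ y ∈ I, a y = some z := by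
      simp only [exchange, Finset.mem_filter, Finset.mem_univ, true_and]
      constructor
      · rintro (h | ⟨x, y, h, h', rfl | rfl⟩)
        · exact absurd h hz
        · exact Or.inr ⟨y, h'.resolve_left hz, h⟩
        · exact Or.inl ⟨x, h'.resolve_right hz, h⟩
      · rintro (⟨x, hx, h⟩ | ⟨y, hy, h⟩)
        · exact Or.inr ⟨x, z, h, Or.inl hx, Or.inr rfl⟩
        · exact Or.inr ⟨z, y, h, Or.inr hy, Or.inl rfl⟩
    by_cases hp : ∃ x ∈ I, a z = some x <;> by_cases hq : ∃ y ∈ I, a y = some z <;>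
      simp only [h3, hp, hq] <;> norm_num
  have h4 : ∑ z ∈ I, (if z ∈ exchange I a then (1 : ℝ) else 0) = I.card := by
    rw [Finset.sum_congr rfl (g := fun _ => (1 : ℝ))]
    · simp
    · intro z hz
      simp [exchange, hz]
  rw [h1, ← Finset.sum_add_sum_compl I, h4, Finset.sum_congr rfl fun z hz => h2 z hz,
    Finset.sum_sub_distrib, Finset.sum_add_distrib, acceptCount, acceptCount,
    Finset.sum_comm (s := I) (t := Iᶜ), overlap]
  ring

/-- All callers are uninformed and distinct accepted calls have distinct callers, so each node of
`I` that is called contributes exactly one new node. -/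
theorem card_exchange_pull {I : Finset (Fin n)} {a : Fin n → Option (Fin n)}
    (h : a ∈ (acceptLaw Iᶜ).support) :
    ((exchange I a).card : ℝ) = I.card + ∑ y ∈ I, (1 - idle a y) := by
  have h0 : ∀ y, ∀ x ∈ I, accepts a y x = 0 := by
    intro y x hx
    rw [accepts, if_neg]
    intro h'
    exact Finset.mem_compl.1 (mem_callers_of_mem_support h h') hx
  have h1 : acceptCount Iᶜ I a = 0 :=
    Finset.sum_eq_zero fun y _ => Finset.sum_eq_zero fun x hx => h0 y x hx
  have h2 : overlap I a = 0 := Finset.sum_eq_zero fun z _ => by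
    rw [Finset.sum_eq_zero fun x hx => h0 z x hx, zero_mul]
  rw [card_exchange (isInjAccept_of_mem_support h), h1, h2, acceptCount]
  simp only [← sum_univ_accepts]
  rw [add_zero, sub_zero]
  congr 1
  refine Finset.sum_congr rfl fun y _ => ?_
  rw [← Finset.sum_add_sum_compl I, Finset.sum_eq_zero fun x hx => h0 y x hx, zero_add]


/-! ### Moments of the number of accepted calls. -/

theorem card_le_n (I : Finset (Fin n)) : (I.card : ℝ) ≤ n := by
  have := Finset.card_le_univ I
  rw [Fintype.card_fin] at this
  exact_mod_cast this

theorem ev_idle (A : Finset (Fin n)) (y : Fin n) :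
    ev (acceptLaw A) (fun a => idle a y) = (1 - 1 / n) ^ A.card := by
  simpa using ev_prod_idle A {y}

theorem ev_idle_mul_idle (A : Finset (Fin n)) {y y' : Fin n} (h : y ≠ y') :
    ev (acceptLaw A) (fun a => idle a y * idle a y') = (1 - 2 / n) ^ A.card := by
  simpa [Finset.prod_pair h, Finset.card_pair h] using ev_prod_idle A {y, y'}

theorem ev_not_idle_mul (A : Finset (Fin n)) {y y' : Fin n} (h : y ≠ y') :
    ev (acceptLaw A) (fun a => (1 - idle a y) * (1 - idle a y')) =
      1 - 2 * (1 - 1 / n : ℝ) ^ A.card + (1 - 2 / n) ^ A.card := by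
  have h1 : ∀ a, (1 - idle a y) * (1 - idle a y') =
      (1 - (idle a y + idle a y')) + idle a y * idle a y' := fun a => by ring
  simp only [h1]
  rw [ev_add, ev_sub, ev_const, ev_add, ev_idle, ev_idle, ev_idle_mul_idle A h]
  ring

theorem two_le_of_ne {y y' : Fin n} (h : y ≠ y') : 2 ≤ n := by
  have := y.isLt
  have := y'.isLt
  by_contra hn
  exact h (Fin.ext (by omega))

/-- Negative correlation, from `1 - 2/n ≤ (1 - 1/n)^2`. -/
theorem ev_not_idle_mul_le (A : Finset (Fin n)) {y y' : Fin n} (h : y ≠ y') :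
    ev (acceptLaw A) (fun a => (1 - idle a y) * (1 - idle a y')) ≤
      (1 - (1 - 1 / n : ℝ) ^ A.card) ^ 2 := by
  rw [ev_not_idle_mul A h]
  have hn : (2 : ℝ) ≤ n := by exact_mod_cast two_le_of_ne h
  have h1 : (1 - 2 / n : ℝ) ^ A.card ≤ ((1 - 1 / n : ℝ) ^ 2) ^ A.card := by
    apply pow_le_pow_left₀
    · rw [sub_nonneg, div_le_one (by linarith)]
      exact hn
    · have : (1 - 1 / n : ℝ) ^ 2 = 1 - 2 / n + (1 / n) ^ 2 := by ring
      rw [this]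
      nlinarith [sq_nonneg (1 / n : ℝ)]
  rw [← pow_mul, mul_comm, pow_mul] at h1
  nlinarith

/-- The probability that a given node receives no call when all nodes call. -/
def idleProb (n : ℕ) : ℝ := (1 - 1 / n) ^ n

theorem ev_idle_univ (y : Fin n) :
    ev (acceptLaw Finset.univ) (fun a => idle a y) = idleProb n := by
  rw [ev_idle, Finset.card_univ, Fintype.card_fin, idleProb]

theorem ev_accepts (y x : Fin n) :
    ev (acceptLaw Finset.univ) (fun a => accepts a y x) = (1 - idleProb n) / n := by
  rw [ev_eq_average (fun x a => accepts a y x) (fun σ x a => accepts_relabel σ a y x)]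
  simp only [sum_univ_accepts]
  rw [ev_sub, ev_const, ev_idle_univ]

/-- The diagonal may be dropped because two different nodes never accept calls of the same caller.
-/
theorem sum_offDiag_accepts {a : Fin n → Option (Fin n)} (ha : IsInjAccept a) {y y' : Fin n}
    (h : y ≠ y') (X : Finset (Fin n)) :
    ∑ z ∈ X.offDiag, accepts a y z.1 * accepts a y' z.2 =
      (∑ x ∈ X, accepts a y x) * ∑ x ∈ X, accepts a y' x := by
  rw [Finset.sum_mul_sum, ← Finset.sum_product', ← Finset.diag_union_offDiag,
    Finset.sum_union (Finset.disjoint_diag_offDiag X)]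
  refine (zero_add _).symm.trans (congrArg (· + _) (Eq.symm (Finset.sum_eq_zero ?_)))
  intro z hz
  obtain ⟨-, hz⟩ := Finset.mem_diag.1 hz
  by_cases h1 : a y = some z.1
  · have h2 : accepts a y' z.2 = 0 := by
      rw [accepts, if_neg]
      intro h2
      rw [← hz] at h2
      exact h (ha h1 h2)
    rw [h2, mul_zero]
  · rw [accepts, if_neg h1, zero_mul]

/-- Averaged over ordered pairs of callers, the product becomes the event that `y` and `y'` are both
called, which is negatively correlated. -/
theorem ev_accepts_mul_le {y y' x x' : Fin n} (h : y ≠ y') (hx : x ≠ x') :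
    ev (acceptLaw Finset.univ) (fun a => accepts a y x * accepts a y' x') ≤
      (1 - idleProb n) ^ 2 / (n * (n - 1)) := by
  have hn : (2 : ℝ) ≤ n := by exact_mod_cast two_le_of_ne h
  rw [ev_pair_eq_average (fun x x' a => accepts a y x * accepts a y' x')
    (fun σ x x' a => by rw [accepts_relabel, accepts_relabel]) hx]
  have h1 := ev_not_idle_mul_le Finset.univ h
  rw [Finset.card_univ, Fintype.card_fin] at h1
  refine div_le_div_of_nonneg_right (le_trans (le_of_eq ?_) h1) (by nlinarith)
  refine ev_congr_support _ fun a ha => ?_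
  rw [sum_offDiag_accepts (isInjAccept_of_mem_support ha) h, sum_univ_accepts, sum_univ_accepts]

theorem idleProb_nonneg (hn : 2 ≤ n) : 0 ≤ idleProb n := by
  have : (2 : ℝ) ≤ n := by exact_mod_cast hn
  apply pow_nonneg
  rw [sub_nonneg, div_le_one (by linarith)]
  linarith

theorem idleProb_le (hn : 2 ≤ n) : idleProb n ≤ 1 / Real.exp 1 := by
  have hn' : (2 : ℝ) ≤ n := by exact_mod_cast hn
  have h1 : (1 - 1 / n : ℝ) ≤ Real.exp (-(1 / n)) := by
    have := Real.add_one_le_exp (-(1 / n : ℝ))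
    linarith
  have h2 : (0 : ℝ) ≤ 1 - 1 / n := by
    rw [sub_nonneg, div_le_one (by linarith)]
    linarith
  calc idleProb n ≤ (Real.exp (-(1 / n))) ^ n := pow_le_pow_left₀ h2 h1 n
    _ = 1 / Real.exp 1 := by
      rw [← Real.exp_nat_mul, one_div (Real.exp 1), ← Real.exp_neg]
      congr 1
      field_simp

/-- With `m = n - 1`, `1 - 1/n` is the inverse of `1 + 1/m`, so its `m`-th power is at least `1/e`;
the remaining factor costs at most `1/n`. -/
theorem le_idleProb (hn : 2 ≤ n) : 1 / Real.exp 1 - 1 / n ≤ idleProb n := by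
  have hn' : (2 : ℝ) ≤ n := by exact_mod_cast hn
  obtain ⟨m, rfl⟩ : ∃ m, n = m + 1 := ⟨n - 1, by omega⟩
  have hm : (1 : ℝ) ≤ m := by
    push_cast at hn'
    linarith
  have h1 : (1 + 1 / m : ℝ) ≤ Real.exp (1 / m) := by
    have := Real.add_one_le_exp (1 / m : ℝ)
    linarith
  have h2 : (1 + 1 / m : ℝ) ^ m ≤ Real.exp 1 := by
    calc (1 + 1 / m : ℝ) ^ m ≤ (Real.exp (1 / m)) ^ m := pow_le_pow_left₀ (by positivity) h1 m
      _ = Real.exp 1 := by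
        rw [← Real.exp_nat_mul]
        congr 1
        field_simp
  have h3 : (1 - 1 / ((m + 1 : ℕ) : ℝ)) = (1 + 1 / m : ℝ)⁻¹ := by
    push_cast
    field_simp
    ring
  have h4 : 1 / Real.exp 1 ≤ (1 - 1 / ((m + 1 : ℕ) : ℝ)) ^ m := by
    rw [h3, inv_pow, one_div]
    exact inv_anti₀ (by positivity) h2
  have h5 : 1 / Real.exp 1 ≤ 1 := by
    rw [div_le_one (Real.exp_pos 1)]
    exact Real.one_le_exp (by norm_num)
  have h6 : (0 : ℝ) ≤ 1 / ((m + 1 : ℕ) : ℝ) := by positivity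
  have h7 : (0 : ℝ) ≤ 1 - 1 / ((m + 1 : ℕ) : ℝ) := by rw [h3]; positivity
  have h8 : 1 / Real.exp 1 * (1 - 1 / ((m + 1 : ℕ) : ℝ)) ≤ idleProb (m + 1) := by
    rw [idleProb, pow_succ]
    exact mul_le_mul_of_nonneg_right h4 h7
  nlinarith

theorem one_div_exp_le : 1 / Real.exp 1 ≤ 2 / 5 := by
  have := Real.exp_one_gt_d9
  rw [div_le_iff₀ (Real.exp_pos 1)]
  linarith

theorem ev_acceptCount (Y X : Finset (Fin n)) :
    ev (acceptLaw Finset.univ) (acceptCount Y X) = Y.card * X.card * (1 - idleProb n) / n := by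
  unfold acceptCount
  rw [ev_sum]
  simp only [ev_sum, ev_accepts, Finset.sum_const, nsmul_eq_mul]
  ring

/-- Equal callees reproduce the count itself, being 0-1 variables; distinct callees are handled by
the pair bound. The variance is thus at most the mean. -/
theorem ev_acceptCount_sq_le (hn : 2 ≤ n) (Y X : Finset (Fin n)) :
    ev (acceptLaw Finset.univ) (fun a => acceptCount Y X a ^ 2) ≤
      (Y.card * X.card * (1 - idleProb n) / n) ^ 2 + Y.card * X.card * (1 - idleProb n) / n := by
  have hn' : (2 : ℝ) ≤ n := by exact_mod_cast hn
  have h1 : ∀ a ∈ (acceptLaw (Finset.univ : Finset (Fin n))).support, acceptCount Y X a ^ 2 =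
      acceptCount Y X a + ∑ w ∈ Y.offDiag, ∑ z ∈ X.offDiag,
        accepts a w.1 z.1 * accepts a w.2 z.2 := by
    intro a ha
    have hinj := isInjAccept_of_mem_support ha
    rw [pow_two]
    nth_rw 1 2 [acceptCount]
    rw [Finset.sum_mul_sum, ← Finset.sum_product', ← Finset.diag_union_offDiag,
      Finset.sum_union (Finset.disjoint_diag_offDiag Y), Finset.sum_diag]
    congr 1
    · rw [acceptCount]
      refine Finset.sum_congr rfl fun y _ => ?_
      rw [sum_accepts_callee]
      split_ifs <;> norm_num
    · refine Finset.sum_congr rfl fun w hw => ?_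
      rw [sum_offDiag_accepts hinj (Finset.mem_offDiag.1 hw).2.2]
  rw [ev_congr_support _ h1, ev_add, ev_acceptCount, add_comm, ev_sum]
  refine add_le_add_left ?_ _
  have h2 : ∀ w ∈ Y.offDiag, ev (acceptLaw Finset.univ) (fun a => ∑ z ∈ X.offDiag,
      accepts a w.1 z.1 * accepts a w.2 z.2) ≤
        (X.offDiag.card : ℝ) * ((1 - idleProb n) ^ 2 / (n * (n - 1))) := by
    intro w hw
    rw [ev_sum, ← nsmul_eq_mul]
    exact Finset.sum_le_card_nsmul _ _ _ fun z hz =>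
      ev_accepts_mul_le (Finset.mem_offDiag.1 hw).2.2 (Finset.mem_offDiag.1 hz).2.2
  refine (Finset.sum_le_card_nsmul _ _ _ h2).trans ?_
  rw [nsmul_eq_mul, Finset.offDiag_card, Finset.offDiag_card, Nat.cast_sub (Nat.le_mul_self _),
    Nat.cast_sub (Nat.le_mul_self _)]
  push_cast
  set y : ℝ := (Y.card : ℝ)
  set x : ℝ := (X.card : ℝ)
  have hx : x ≤ n := card_le_n X
  have hx0 : 0 ≤ x := by positivity
  have hy0 : 0 ≤ y := by positivity
  -- Excluding equal callers makes up for the denominator `n (n - 1)` in place of `n^2`; this uses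
  -- `x ≤ n`.
  have h3 : x * x - x ≤ x ^ 2 * (n - 1) / n := by
    rw [le_div_iff₀ (by linarith)]
    nlinarith
  have h4 : 0 ≤ (1 - idleProb n) ^ 2 / (n * (n - 1)) := by
    apply div_nonneg (sq_nonneg _)
    nlinarith
  calc (y * y - y) * ((x * x - x) * ((1 - idleProb n) ^ 2 / (n * (n - 1))))
      ≤ y ^ 2 * ((x ^ 2 * (n - 1) / n) * ((1 - idleProb n) ^ 2 / (n * (n - 1)))) := by
        have h5 : (0 : ℝ) ≤ x ^ 2 * (n - 1) / n := by
          apply div_nonneg _ (by linarith)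
          apply mul_nonneg (sq_nonneg _)
          linarith
        have h6 := mul_le_mul_of_nonneg_right h3 h4
        calc _ ≤ (y * y) * ((x * x - x) * ((1 - idleProb n) ^ 2 / (n * (n - 1)))) := by
              refine mul_le_mul_of_nonneg_right (by linarith) (mul_nonneg ?_ h4)
              have : (X.card : ℝ) ≤ X.card * X.card := by exact_mod_cast Nat.le_mul_self X.card
              simpa [x] using this
          _ ≤ _ := by
              rw [pow_two y]
              exact mul_le_mul_of_nonneg_left h6 (by positivity)
    _ = (y * x * (1 - idleProb n) / n) ^ 2 := by
        have : (n : ℝ) - 1 ≠ 0 := by linarith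
        field_simp

theorem ev_sq_sub (p : PMF (Fin n → Option (Fin n))) (f : (Fin n → Option (Fin n)) → ℝ) (m : ℝ) :
    ev p (fun a => (f a - m) ^ 2) = ev p (fun a => f a ^ 2) - 2 * m * ev p f + m ^ 2 := by
  have h : ∀ a, (f a - m) ^ 2 = (f a ^ 2 - (2 * m) * f a) + m ^ 2 := fun a => by ring
  simp only [h]
  rw [ev_add, ev_sub, ev_mul, ev_const]

theorem variance_acceptCount_le (hn : 2 ≤ n) (Y X : Finset (Fin n)) :
    ev (acceptLaw Finset.univ)
      (fun a => (acceptCount Y X a - Y.card * X.card * (1 - idleProb n) / n) ^ 2) ≤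
        Y.card * X.card * (1 - idleProb n) / n := by
  rw [ev_sq_sub, ev_acceptCount]
  nlinarith [ev_acceptCount_sq_le hn Y X]

theorem card_compl_eq (I : Finset (Fin n)) : (Iᶜ.card : ℝ) = n - I.card := by
  have h := Finset.card_compl_add_card I
  rw [Fintype.card_fin] at h
  rw [eq_sub_iff_add_eq]
  exact_mod_cast h

theorem ev_overlap_le (hn : 2 ≤ n) {I : Finset (Fin n)} (hI : I.Nonempty) :
    ev (acceptLaw Finset.univ) (overlap I) ≤ (I.card : ℝ) ^ 2 / n := by
  have hn' : (2 : ℝ) ≤ n := by exact_mod_cast hn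
  have h1 : ∀ z ∈ Iᶜ, ev (acceptLaw Finset.univ)
      (fun a => (∑ x ∈ I, accepts a z x) * ∑ y ∈ I, accepts a y z) ≤
        (I.card : ℝ) * (I.card * (1 / (n * (n - 1)))) := by
    intro z hz
    rw [Finset.mem_compl] at hz
    simp only [Finset.sum_mul_sum]
    rw [ev_sum, ← nsmul_eq_mul]
    refine Finset.sum_le_card_nsmul _ _ _ fun x hx => ?_
    rw [ev_sum, ← nsmul_eq_mul]
    refine Finset.sum_le_card_nsmul _ _ _ fun y hy => ?_
    refine (ev_accepts_mul_le (ne_of_mem_of_not_mem hy hz).symm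
      (ne_of_mem_of_not_mem hx hz)).trans ?_
    refine div_le_div_of_nonneg_right ?_ (by nlinarith)
    have h2 := idleProb_nonneg hn
    have h3 := (idleProb_le hn).trans one_div_exp_le
    nlinarith
  unfold overlap
  rw [ev_sum]
  refine (Finset.sum_le_card_nsmul _ _ _ h1).trans ?_
  rw [nsmul_eq_mul, card_compl_eq]
  have hk : (1 : ℝ) ≤ I.card := by exact_mod_cast hI.card_pos
  set k : ℝ := (I.card : ℝ)
  have h2 : (n - k) * (1 / (n * (n - 1))) ≤ 1 / n := by
    rw [mul_one_div, div_le_div_iff₀ (by nlinarith) (by linarith)]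
    nlinarith
  calc (n - k) * (k * (k * (1 / (n * (n - 1))))) = k ^ 2 * ((n - k) * (1 / (n * (n - 1)))) := by
        ring
    _ ≤ k ^ 2 * (1 / n) := mul_le_mul_of_nonneg_left h2 (by positivity)
    _ = k ^ 2 / n := by ring

theorem overlap_nonneg (I : Finset (Fin n)) (a : Fin n → Option (Fin n)) : 0 ≤ overlap I a :=
  Finset.sum_nonneg fun z _ => mul_nonneg (Finset.sum_nonneg fun x _ => accepts_nonneg a z x)
    (Finset.sum_nonneg fun y _ => accepts_nonneg a y z)

theorem overlap_le (I : Finset (Fin n)) (a : Fin n → Option (Fin n)) :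
    overlap I a ≤ acceptCount I Iᶜ a := by
  rw [overlap, acceptCount, Finset.sum_comm]
  refine Finset.sum_le_sum fun z _ => ?_
  rw [sum_accepts_callee]
  have : 0 ≤ ∑ y ∈ I, accepts a y z := Finset.sum_nonneg fun y _ => accepts_nonneg a y z
  split_ifs <;> linarith

theorem acceptCount_le_callees (Y X : Finset (Fin n)) (a : Fin n → Option (Fin n)) :
    acceptCount Y X a ≤ Y.card := by
  have h : ∀ y ∈ Y, ∑ x ∈ X, accepts a y x ≤ 1 := fun y _ => by
    rw [sum_accepts_callee]
    split_ifs <;> norm_num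
  simpa [acceptCount] using Finset.sum_le_card_nsmul _ _ _ h

theorem acceptCount_le_callers {a : Fin n → Option (Fin n)} (ha : IsInjAccept a)
    (Y X : Finset (Fin n)) : acceptCount Y X a ≤ X.card := by
  have h : ∀ x ∈ X, ∑ y ∈ Y, accepts a y x ≤ 1 := fun x _ => by
    rw [sum_accepts_caller ha]
    split_ifs <;> norm_num
  rw [acceptCount, Finset.sum_comm]
  simpa using Finset.sum_le_card_nsmul _ _ _ h

theorem card_le_card_exchange (I : Finset (Fin n)) (a : Fin n → Option (Fin n)) :
    (I.card : ℝ) ≤ (exchange I a).card := by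
  exact_mod_cast Finset.card_le_card fun z hz => by simp [exchange, hz]

theorem card_exchange_le {a : Fin n → Option (Fin n)} (ha : IsInjAccept a)
    (I : Finset (Fin n)) : ((exchange I a).card : ℝ) ≤ 3 * I.card := by
  have h1 := acceptCount_le_callers ha Iᶜ I
  have h2 := acceptCount_le_callees I Iᶜ a
  have h3 := overlap_nonneg I a
  rw [card_exchange ha]
  linarith

/-! ### One push-pull round: growth of the informed set. -/

theorem ev_card_pushPull_le (hn : 2 ≤ n) (I : Finset (Fin n)) :
    ev (roundLaw Finset.univ I) (fun S => (S.card : ℝ)) ≤ (3 - 2 * idleProb n) * I.card := by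
  have hn' : (2 : ℝ) ≤ n := by exact_mod_cast hn
  rw [ev_roundLaw]
  have h1 : ev (acceptLaw Finset.univ) (fun a => ((exchange I a).card : ℝ)) ≤
      ev (acceptLaw Finset.univ)
        (fun a => (I.card : ℝ) + (acceptCount Iᶜ I a + acceptCount I Iᶜ a)) := by
    refine ev_mono_support _ fun a ha => ?_
    rw [card_exchange (isInjAccept_of_mem_support ha)]
    linarith [overlap_nonneg I a]
  refine h1.trans ?_
  rw [ev_add, ev_const, ev_add, ev_acceptCount, ev_acceptCount, card_compl_eq]
  have h2 := (idleProb_le hn).trans one_div_exp_le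
  have hk := card_le_n I
  have hk0 : (0 : ℝ) ≤ I.card := by positivity
  set k : ℝ := (I.card : ℝ)
  have h3 : (n - k) * k * (1 - idleProb n) / n ≤ k * (1 - idleProb n) := by
    rw [div_le_iff₀ (by linarith)]
    nlinarith [mul_nonneg hk0 (by linarith : 0 ≤ 1 - idleProb n)]
  have h4 : k * (n - k) * (1 - idleProb n) / n = (n - k) * k * (1 - idleProb n) / n := by ring
  rw [h4]
  linarith

theorem le_ev_card_pushPull (hn : 2 ≤ n) {I : Finset (Fin n)} (hI : I.Nonempty) :
    (3 - 2 * idleProb n) * I.card - 3 * (I.card : ℝ) ^ 2 / n ≤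
      ev (roundLaw Finset.univ I) (fun S => (S.card : ℝ)) := by
  have hn' : (2 : ℝ) ≤ n := by exact_mod_cast hn
  rw [ev_roundLaw]
  have h1 : ev (acceptLaw Finset.univ) (fun a => ((exchange I a).card : ℝ)) =
      ev (acceptLaw Finset.univ)
        (fun a => (I.card : ℝ) + (acceptCount Iᶜ I a + acceptCount I Iᶜ a) - overlap I a) := by
    refine ev_congr_support _ fun a ha => ?_
    rw [card_exchange (isInjAccept_of_mem_support ha)]
    ring
  rw [h1, ev_sub, ev_add, ev_const, ev_add, ev_acceptCount, ev_acceptCount, card_compl_eq]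
  have h2 := idleProb_nonneg hn
  have h3 := ev_overlap_le hn hI
  set k : ℝ := (I.card : ℝ)
  have h4 : (n - k) * k * (1 - idleProb n) / n = k * (1 - idleProb n) -
      (1 - idleProb n) * (k ^ 2 / n) := by
    field_simp
  have h5 : k * (n - k) * (1 - idleProb n) / n = (n - k) * k * (1 - idleProb n) / n := by ring
  rw [h5, h4]
  have h6 : 0 ≤ k ^ 2 / n := by positivity
  have h7 : 3 * k ^ 2 / n = 3 * (k ^ 2 / n) := by ring
  rw [h7]
  nlinarith

/-- The growth factor of the push-pull phase. -/
def growth : ℝ := 3 - 2 / Real.exp 1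

theorem two_le_growth : 2 ≤ growth := by
  have := one_div_exp_le
  have h : 2 / Real.exp 1 = 2 * (1 / Real.exp 1) := by ring
  rw [growth, h]
  linarith

theorem growth_le_three : growth ≤ 3 := by
  have : 0 < 2 / Real.exp 1 := by positivity
  rw [growth]
  linarith

theorem growth_eq : growth = 3 - 2 * (1 / Real.exp 1) := by rw [growth]; ring

theorem add_sub_sq_le (p q d o : ℝ) :
    (p + q + d - o) ^ 2 ≤ 4 * (p ^ 2 + q ^ 2 + d ^ 2 + o ^ 2) := by
  linarith [sq_nonneg (p - q), sq_nonneg (p - d), sq_nonneg (q - d), sq_nonneg (p + o),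
    sq_nonneg (q + o), sq_nonneg (d + o)]

/-- The error splits into two centred accepted-call counts with variance at most `k` each, a bias
with square at most `4 k^3/n`, and the overlap, whose square is at most `k` times itself. -/
theorem ev_sq_card_pushPull_le (hn : 2 ≤ n) {I : Finset (Fin n)} (hI : I.Nonempty) :
    ev (roundLaw Finset.univ I) (fun S => ((S.card : ℝ) - growth * I.card) ^ 2) ≤
      8 * I.card + 20 * (I.card : ℝ) ^ 3 / n := by
  have hn' : (2 : ℝ) ≤ n := by exact_mod_cast hn
  rw [ev_roundLaw]
  have hk1 : (1 : ℝ) ≤ I.card := by exact_mod_cast hI.card_pos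
  have hk := card_le_n I
  have h1 := variance_acceptCount_le hn Iᶜ I
  have h2 := variance_acceptCount_le hn I Iᶜ
  have h3 := ev_overlap_le hn hI
  rw [card_compl_eq] at h1 h2
  have h4 : (I.card : ℝ) * (n - I.card) * (1 - idleProb n) / n =
      (n - I.card) * I.card * (1 - idleProb n) / n := by ring
  rw [h4] at h2
  have hpt : ∀ a ∈ (acceptLaw (Finset.univ : Finset (Fin n))).support, overlap I a ≤ I.card :=
    fun a _ => (overlap_le I a).trans (acceptCount_le_callees _ _ _)
  set k : ℝ := (I.card : ℝ) with hkdef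
  set m : ℝ := (n - k) * k * (1 - idleProb n) / n with hm
  have hr1 := idleProb_le hn
  have hr2 := le_idleProb hn
  have hr3 := idleProb_nonneg hn
  have hr4 := one_div_exp_le
  have h1n : 1 / (n : ℝ) ≤ k / n := div_le_div_of_nonneg_right hk1 (by linarith)
  have hkn : 0 ≤ k / n := by positivity
  have hkn1 : k / n ≤ 1 := by rw [div_le_one (by linarith)]; exact hk
  have hmk : m ≤ k := by
    rw [hm, div_le_iff₀ (by linarith)]
    have : (n - k) * (1 - idleProb n) ≤ n := by nlinarith
    nlinarith
  have hdiff : 2 * m + k - growth * k =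
      2 * k * ((1 / Real.exp 1 - idleProb n) - k / n * (1 - idleProb n)) := by
    rw [hm, growth_eq]
    field_simp
    ring
  have hsq : (2 * m + k - growth * k) ^ 2 ≤ 4 * (k ^ 3 / n) := by
    have h5 : ((1 / Real.exp 1 - idleProb n) - k / n * (1 - idleProb n)) ^ 2 ≤ (k / n) ^ 2 := by
      have h6 : 0 ≤ k / n * idleProb n := mul_nonneg hkn hr3
      have h7 : k / n * idleProb n ≤ k / n := mul_le_of_le_one_right hkn (by linarith)
      apply sq_le_sq' <;> linarith
    rw [hdiff, mul_pow]
    calc (2 * k) ^ 2 * ((1 / Real.exp 1 - idleProb n) - k / n * (1 - idleProb n)) ^ 2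
        ≤ (2 * k) ^ 2 * (k / n) ^ 2 := mul_le_mul_of_nonneg_left h5 (by positivity)
      _ ≤ (2 * k) ^ 2 * (k / n) := mul_le_mul_of_nonneg_left (by nlinarith) (by positivity)
      _ = 4 * (k ^ 3 / n) := by ring
  have hmain : ev (acceptLaw Finset.univ) (fun a => (((exchange I a).card : ℝ) - growth * k) ^ 2) ≤
      ev (acceptLaw Finset.univ) (fun a => 4 * ((acceptCount Iᶜ I a - m) ^ 2 +
        (acceptCount I Iᶜ a - m) ^ 2 + 4 * (k ^ 3 / n) + k * overlap I a)) := by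
    refine ev_mono_support _ fun a ha => ?_
    rw [card_exchange (isInjAccept_of_mem_support ha), ← hkdef]
    have h6 := hpt a ha
    have h7 := overlap_nonneg I a
    have h8 : overlap I a ^ 2 ≤ k * overlap I a := by nlinarith
    set p := acceptCount Iᶜ I a - m
    set q := acceptCount I Iᶜ a - m
    set o := overlap I a
    set d := 2 * m + k - growth * k
    have h9 : k + acceptCount Iᶜ I a + acceptCount I Iᶜ a - o - growth * k = p + q + d - o := by
      simp only [p, q, d]; ring
    rw [h9]
    have h10 := add_sub_sq_le p q d o
    linarith
  refine hmain.trans ?_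
  rw [ev_mul, ev_add, ev_add, ev_add, ev_const, ev_mul]
  have h10 : k * ev (acceptLaw Finset.univ) (overlap I) ≤ k ^ 3 / n := by
    calc _ ≤ k * (k ^ 2 / n) := mul_le_mul_of_nonneg_left h3 (by linarith)
      _ = k ^ 3 / n := by ring
  have h11 : 20 * k ^ 3 / n = 20 * (k ^ 3 / n) := by ring
  rw [h11]
  linarith

/-- A quadratic minorant touching `log` at `1`. The range `w ≥ 1/3` is enough for `w = |S| / (growth
* |I|)`, as the informed set does not shrink and `growth ≤ 3`. -/
theorem le_log_of_third_le {w : ℝ} (hw : 1 / 3 ≤ w) : (w - 1) - 3 * (w - 1) ^ 2 ≤ Real.log w := by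
  have h0 : 0 < w := by linarith
  refine le_trans ?_ (Real.one_sub_inv_le_log_of_pos h0)
  have h1 : 1 - w⁻¹ = (w - 1) - (w - 1) ^ 2 * w⁻¹ := by
    field_simp
    ring
  rw [h1]
  have h2 : w⁻¹ ≤ 3 := by
    rw [inv_le_comm₀ h0 (by norm_num)]
    linarith
  nlinarith [sq_nonneg (w - 1)]

theorem le_ev_log_card_pushPull (hn : 2 ≤ n) {I : Finset (Fin n)} (hI : I.Nonempty) :
    Real.log I.card + Real.log growth - (24 * (1 / (I.card : ℝ)) + 63 * (I.card / n)) ≤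
      ev (roundLaw Finset.univ I) (fun S => Real.log S.card) := by
  have hn' : (2 : ℝ) ≤ n := by exact_mod_cast hn
  have hk1 : (1 : ℝ) ≤ I.card := by exact_mod_cast hI.card_pos
  have hmean := le_ev_card_pushPull hn hI
  have hsq := ev_sq_card_pushPull_le hn hI
  have hg2 := two_le_growth
  have hg3 := growth_le_three
  rw [ev_roundLaw] at hmean hsq ⊢
  set k : ℝ := (I.card : ℝ) with hkdef
  have hgk : 0 < growth * k := by positivity
  have hpt : ∀ a ∈ (acceptLaw (Finset.univ : Finset (Fin n))).support,
      (Real.log k + Real.log growth - 1 + 1 / (growth * k) * ((exchange I a).card : ℝ)) -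
        3 / (growth * k) ^ 2 * (((exchange I a).card : ℝ) - growth * k) ^ 2 ≤
          Real.log (exchange I a).card := by
    intro a ha
    have h1 := card_le_card_exchange I a
    rw [← hkdef] at h1
    set k' : ℝ := ((exchange I a).card : ℝ)
    have h2 : 1 / 3 ≤ k' / (growth * k) := by
      rw [div_le_div_iff₀ (by norm_num) hgk]
      nlinarith
    have h3 := le_log_of_third_le h2
    rw [Real.log_div (by linarith) hgk.ne', Real.log_mul (by linarith) (by linarith)] at h3
    have h4 : (k' / (growth * k) - 1) - 3 * (k' / (growth * k) - 1) ^ 2 =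
      1 / (growth * k) * k' - 1 - 3 / (growth * k) ^ 2 * (k' - growth * k) ^ 2 := by
      have : growth ≠ 0 := by linarith
      field_simp
    rw [h4] at h3
    linarith
  refine le_trans ?_ (ev_mono_support _ hpt)
  rw [ev_sub, ev_mul, ev_add, ev_mul, ev_const]
  have h5 : 1 - 3 * (k / n) ≤ 1 / (growth * k) *
      ev (acceptLaw Finset.univ) (fun a => ((exchange I a).card : ℝ)) := by
    have h6 : growth * k - 3 * k ^ 2 / n ≤
        ev (acceptLaw Finset.univ) (fun a => ((exchange I a).card : ℝ)) := by
      refine le_trans ?_ hmean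
      have := idleProb_le hn
      rw [growth_eq]
      nlinarith
    rw [one_div_mul_eq_div, le_div_iff₀ hgk]
    refine le_trans ?_ h6
    have h7 : 3 * k ^ 2 / n = 3 * (k / n) * k := by ring
    rw [h7]
    have : 0 ≤ 3 * (k / n) * k := by positivity
    nlinarith
  have h8 : 3 / (growth * k) ^ 2 * ev (acceptLaw Finset.univ)
      (fun a => (((exchange I a).card : ℝ) - growth * k) ^ 2) ≤ 24 * (1 / k) + 60 * (k / n) := by
    calc _ ≤ 3 / (growth * k) ^ 2 * (8 * k + 20 * k ^ 3 / n) :=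
          mul_le_mul_of_nonneg_left hsq (by positivity)
      _ ≤ 3 / k ^ 2 * (8 * k + 20 * k ^ 3 / n) := by
          refine mul_le_mul_of_nonneg_right ?_ (by positivity)
          refine div_le_div_of_nonneg_left (by norm_num) (by positivity) ?_
          exact pow_le_pow_left₀ (by linarith) (by nlinarith) 2
      _ = 24 * (1 / k) + 60 * (k / n) := by
          field_simp
          ring
  linarith

/-- Contraction of `1/|I|` makes the `1/|I|` errors in the growth of `log |I|` summable. -/
theorem ev_inv_card_pushPull_le (hn : 2 ≤ n) {I : Finset (Fin n)} (hI : I.Nonempty) :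
    ev (roundLaw Finset.univ I) (fun S => 1 / (S.card : ℝ)) ≤ 3 / 5 * (1 / I.card) + 1 / n := by
  have hn' : (2 : ℝ) ≤ n := by exact_mod_cast hn
  have hk1 : (1 : ℝ) ≤ I.card := by exact_mod_cast hI.card_pos
  have hmean := le_ev_card_pushPull hn hI
  rw [ev_roundLaw] at hmean ⊢
  set k : ℝ := (I.card : ℝ) with hkdef
  -- By convexity `1/x` lies below its chord over `[k, 3 k]`, and a round at most triples the
  -- informed set.
  have hpt : ∀ a ∈ (acceptLaw (Finset.univ : Finset (Fin n))).support,
      1 / ((exchange I a).card : ℝ) ≤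
        4 / 3 * (1 / k) - 1 / (3 * k ^ 2) * ((exchange I a).card : ℝ) := by
    intro a ha
    have h1 := card_le_card_exchange I a
    have h2 := card_exchange_le (isInjAccept_of_mem_support ha) I
    rw [← hkdef] at h1 h2
    set k' : ℝ := ((exchange I a).card : ℝ)
    have h3 : 4 / 3 * (1 / k) - 1 / (3 * k ^ 2) * k' - 1 / k' =
        (k' - k) * (3 * k - k') / (3 * k ^ 2 * k') := by
      have : k' ≠ 0 := by linarith
      field_simp
      ring
    have h4 : 0 ≤ (k' - k) * (3 * k - k') / (3 * k ^ 2 * k') := by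
      apply div_nonneg
      · exact mul_nonneg (by linarith) (by linarith)
      · have : 0 < k' := by linarith
        positivity
    linarith
  refine (ev_mono_support _ hpt).trans ?_
  rw [ev_sub, ev_const, ev_mul]
  have h5 : 1 / (3 * k ^ 2) * ((3 - 2 * idleProb n) * k - 3 * k ^ 2 / n) ≤ 1 / (3 * k ^ 2) *
      ev (acceptLaw Finset.univ) (fun a => ((exchange I a).card : ℝ)) :=
    mul_le_mul_of_nonneg_left hmean (by positivity)
  have h6 : 1 / (3 * k ^ 2) * ((3 - 2 * idleProb n) * k - 3 * k ^ 2 / n) =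
      (1 - 2 / 3 * idleProb n) * (1 / k) - 1 / n := by
    field_simp
  have h7 := (idleProb_le hn).trans one_div_exp_le
  have h8 : 0 < 1 / k := by positivity
  nlinarith


/-! ### Nodes that take part in no accepted call. -/

theorem rejected_nonneg (a : Fin n → Option (Fin n)) (x : Fin n) : 0 ≤ rejected a x := by
  unfold rejected; split_ifs <;> norm_num

theorem rejected_le_one (a : Fin n → Option (Fin n)) (x : Fin n) : rejected a x ≤ 1 := by
  unfold rejected; split_ifs <;> norm_num

theorem sum_offDiag_mul (X : Finset (Fin n)) (f : Fin n → ℝ) :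
    ∑ z ∈ X.offDiag, f z.1 * f z.2 = (∑ x ∈ X, f x) ^ 2 - ∑ x ∈ X, f x ^ 2 := by
  rw [pow_two, Finset.sum_mul_sum, ← Finset.sum_product', ← Finset.diag_union_offDiag,
    Finset.sum_union (Finset.disjoint_diag_offDiag X), Finset.sum_diag]
  simp only [pow_two]
  ring

theorem sq_idle (a : Fin n → Option (Fin n)) (y : Fin n) : idle a y ^ 2 = idle a y := by
  unfold idle; split_ifs <;> norm_num

theorem sq_rejected (a : Fin n → Option (Fin n)) (x : Fin n) :
    rejected a x ^ 2 = rejected a x := by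
  unfold rejected; split_ifs <;> norm_num

theorem sum_offDiag_rejected {a : Fin n → Option (Fin n)} (ha : IsInjAccept a) :
    ∑ z ∈ Finset.univ.offDiag, rejected a z.1 * rejected a z.2 =
      ∑ z ∈ Finset.univ.offDiag, idle a z.1 * idle a z.2 := by
  rw [sum_offDiag_mul, sum_offDiag_mul, sum_rejected ha]
  simp only [sq_idle, sq_rejected]
  rw [sum_rejected ha]

/-- The probability that a given node takes part in no accepted call when all nodes call. -/
def isolatedProb (n : ℕ) : ℝ := (idleProb n + (n - 1) * (1 - 2 / n) ^ n) / n

/-- Averaging over the caller replaces the rejection indicator by the fraction of idle nodes,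
leaving only pairs of idle nodes. -/
theorem ev_idle_mul_rejected (x : Fin n) :
    ev (acceptLaw Finset.univ) (fun a => idle a x * rejected a x) = isolatedProb n := by
  rw [ev_eq_average (fun z a => idle a x * rejected a z)
    (fun σ z a => by rw [idle_relabel, rejected_relabel])]
  have h : ∀ a ∈ (acceptLaw (Finset.univ : Finset (Fin n))).support,
      ∑ z, idle a x * rejected a z = idle a x + ∑ y ∈ {x}ᶜ, idle a x * idle a y := by
    intro a ha
    rw [← Finset.mul_sum, sum_rejected (isInjAccept_of_mem_support ha), ← Finset.mul_sum,
      ← Finset.sum_add_sum_compl {x}, Finset.sum_singleton, mul_add]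
    nth_rw 1 [← pow_two]
    rw [sq_idle]
  rw [ev_congr_support _ h, ev_add, ev_sum, ev_idle_univ, isolatedProb]
  have h2 : ∀ y ∈ ({x}ᶜ : Finset (Fin n)),
      ev (acceptLaw Finset.univ) (fun a => idle a x * idle a y) = (1 - 2 / n : ℝ) ^ n := by
    intro y hy
    rw [ev_idle_mul_idle, Finset.card_univ, Fintype.card_fin]
    intro hxy
    simp [hxy] at hy
  rw [Finset.sum_congr rfl h2, Finset.sum_const, nsmul_eq_mul, card_compl_eq]
  simp

theorem ev_idle_four_le (hn : 4 ≤ n) {x x' y y' : Fin n} (hx : x ≠ x') (hy : y ≠ y') :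
    ev (acceptLaw Finset.univ) (fun a => idle a x * idle a x' * (idle a y * idle a y')) ≤
      (1 - 4 / n : ℝ) ^ n + ((if y = x then 1 else 0) + (if y = x' then 1 else 0) +
        (if y' = x then 1 else 0) + (if y' = x' then 1 else 0)) := by
  have hn' : (4 : ℝ) ≤ n := by exact_mod_cast hn
  have hnn : 0 ≤ (1 - 4 / n : ℝ) ^ n := by
    apply pow_nonneg
    rw [sub_nonneg, div_le_one (by linarith)]
    exact hn'
  by_cases h : y = x ∨ y = x' ∨ y' = x ∨ y' = x'
  · have h1 : ev (acceptLaw Finset.univ) (fun a => idle a x * idle a x' * (idle a y * idle a y')) ≤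
        1 := by
      rw [← ev_const (acceptLaw (Finset.univ : Finset (Fin n))) 1]
      refine ev_mono _ fun a => ?_
      exact mul_le_one₀ (mul_le_one₀ (idle_le_one a x) (idle_nonneg a x') (idle_le_one a x'))
        (mul_nonneg (idle_nonneg a y) (idle_nonneg a y'))
        (mul_le_one₀ (idle_le_one a y) (idle_nonneg a y') (idle_le_one a y'))
    have h2 : (1 : ℝ) ≤ (if y = x then 1 else 0) + (if y = x' then 1 else 0) +
        (if y' = x then 1 else 0) + (if y' = x' then 1 else 0) := by
      have e1 : ∀ p : Prop, ∀ _ : Decidable p, (0 : ℝ) ≤ if p then 1 else 0 := fun p _ => by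
        split_ifs <;> norm_num
      have i1 := e1 (y = x) inferInstance
      have i2 := e1 (y = x') inferInstance
      have i3 := e1 (y' = x) inferInstance
      have i4 := e1 (y' = x') inferInstance
      rcases h with h | h | h | h
      · rw [if_pos h]; linarith
      · rw [if_pos h (c := y = x')]; linarith
      · rw [if_pos h (c := y' = x)]; linarith
      · rw [if_pos h (c := y' = x')]; linarith
    linarith
  · push Not at h
    obtain ⟨h1, h2, h3, h4⟩ := h
    have hcard : ({x, x', y, y'} : Finset (Fin n)).card = 4 := by
      rw [Finset.card_insert_of_notMem (by simp [hx, h1.symm, h3.symm]),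
        Finset.card_insert_of_notMem (by simp [h2.symm, h4.symm]), Finset.card_pair hy]
    have h5 := ev_prod_idle Finset.univ {x, x', y, y'}
    rw [hcard, Finset.card_univ, Fintype.card_fin] at h5
    have h6 : ∀ a : Fin n → Option (Fin n), ∏ y ∈ {x, x', y, y'}, idle a y =
        idle a x * idle a x' * (idle a y * idle a y') := by
      intro a
      rw [Finset.prod_insert (by simp [hx, h1.symm, h3.symm]),
        Finset.prod_insert (by simp [h2.symm, h4.symm]), Finset.prod_pair hy]
      ring
    simp only [h6] at h5
    rw [h5, if_neg h1, if_neg h2, if_neg h3, if_neg h4]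
    norm_num

theorem sum_offDiag_univ_fst (x : Fin n) :
    ∑ z ∈ (Finset.univ : Finset (Fin n)).offDiag, (if z.1 = x then (1 : ℝ) else 0) = n - 1 := by
  have h : (Finset.univ : Finset (Fin n)).offDiag.filter (fun z => z.1 = x) =
      ({x}ᶜ : Finset (Fin n)).image fun y => (x, y) := by
    ext ⟨y, z⟩
    simp only [Finset.mem_filter, Finset.mem_offDiag, Finset.mem_univ, true_and, Finset.mem_image,
      Finset.mem_compl, Finset.mem_singleton, Prod.mk.injEq]
    constructor
    · rintro ⟨h1, rfl⟩
      exact ⟨z, Ne.symm h1, rfl, rfl⟩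
    · rintro ⟨w, h1, rfl, rfl⟩
      exact ⟨Ne.symm h1, rfl⟩
  rw [← Finset.sum_filter, h, Finset.sum_const,
    Finset.card_image_of_injective _ (Prod.mk_right_injective x), nsmul_eq_mul, card_compl_eq]
  simp

theorem sum_offDiag_univ_snd (x : Fin n) :
    ∑ z ∈ (Finset.univ : Finset (Fin n)).offDiag, (if z.2 = x then (1 : ℝ) else 0) = n - 1 := by
  rw [← sum_offDiag_univ_fst x]
  refine Finset.sum_nbij' Prod.swap Prod.swap ?_ ?_ ?_ ?_ ?_ <;> simp +contextual [eq_comm]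

/-- Averaging over pairs of callers leaves four idle nodes. Coincidences among them are bounded
trivially and cost at most `4 (n - 1)` among `n (n - 1)` pairs. -/
theorem ev_isolated_pair_le (hn : 4 ≤ n) {x x' : Fin n} (hx : x ≠ x') :
    ev (acceptLaw Finset.univ) (fun a => idle a x * rejected a x * (idle a x' * rejected a x')) ≤
      (1 - 4 / n : ℝ) ^ n + 4 / n := by
  have hn' : (4 : ℝ) ≤ n := by exact_mod_cast hn
  have h0 : ∀ a, idle a x * rejected a x * (idle a x' * rejected a x') =
      idle a x * idle a x' * (rejected a x * rejected a x') := fun a => by ring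
  simp only [h0]
  rw [ev_pair_eq_average (fun z z' a => idle a x * idle a x' * (rejected a z * rejected a z'))
    (fun σ z z' a => by simp only [idle_relabel, rejected_relabel]) hx]
  have h1 : ∀ a ∈ (acceptLaw (Finset.univ : Finset (Fin n))).support,
      ∑ z ∈ Finset.univ.offDiag, idle a x * idle a x' * (rejected a z.1 * rejected a z.2) =
        ∑ z ∈ Finset.univ.offDiag, idle a x * idle a x' * (idle a z.1 * idle a z.2) := by
    intro a ha
    rw [← Finset.mul_sum, sum_offDiag_rejected (isInjAccept_of_mem_support ha), Finset.mul_sum]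
  rw [ev_congr_support _ h1, ev_sum, div_le_iff₀ (by nlinarith)]
  refine (Finset.sum_le_sum fun z hz =>
    ev_idle_four_le hn hx (Finset.mem_offDiag.1 hz).2.2).trans ?_
  rw [Finset.sum_add_distrib, Finset.sum_add_distrib, Finset.sum_add_distrib,
    Finset.sum_add_distrib, sum_offDiag_univ_fst, sum_offDiag_univ_fst, sum_offDiag_univ_snd,
    sum_offDiag_univ_snd, Finset.sum_const, Finset.offDiag_card, nsmul_eq_mul,
    Finset.card_univ, Fintype.card_fin, Nat.cast_sub (Nat.le_mul_self n)]
  push_cast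
  apply le_of_eq
  field_simp
  ring

theorem exp_neg_four_le (hn : 4 ≤ n) : Real.exp (-4) ≤ (1 - 2 / n : ℝ) ^ n := by
  have hn' : (4 : ℝ) ≤ n := by exact_mod_cast hn
  have h0 : (0 : ℝ) < 1 - 2 / n := by
    rw [sub_pos, div_lt_one (by linarith)]
    linarith
  have h1 := Real.one_sub_inv_le_log_of_pos h0
  have h2 : -4 / (n : ℝ) ≤ 1 - (1 - 2 / n : ℝ)⁻¹ := by
    have h3 : 1 - (1 - 2 / n : ℝ)⁻¹ = -2 / (n - 2) := by
      have : (n : ℝ) - 2 ≠ 0 := by linarith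
      field_simp
      ring
    rw [h3, div_le_div_iff₀ (by linarith) (by linarith)]
    nlinarith
  rw [← Real.exp_log (pow_pos h0 n), Real.log_pow]
  apply Real.exp_le_exp.2
  calc (-4 : ℝ) = n * (-4 / n) := by field_simp
    _ ≤ n * Real.log (1 - 2 / n) := mul_le_mul_of_nonneg_left (h2.trans h1) (by linarith)

theorem le_isolatedProb (hn : 4 ≤ n) :
    (1 - 1 / n) * (1 - 2 / n : ℝ) ^ n ≤ isolatedProb n := by
  have hn' : (4 : ℝ) ≤ n := by exact_mod_cast hn
  have h := idleProb_nonneg (n := n) (by omega)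
  rw [isolatedProb, le_div_iff₀ (by linarith)]
  have : (1 - 1 / n) * (1 - 2 / n : ℝ) ^ n * n = (n - 1) * (1 - 2 / n : ℝ) ^ n := by
    field_simp
  rw [this]
  linarith

theorem exp_neg_four_half_le (hn : 4 ≤ n) : Real.exp (-4) / 2 ≤ isolatedProb n := by
  have hn' : (4 : ℝ) ≤ n := by exact_mod_cast hn
  refine le_trans ?_ (le_isolatedProb hn)
  have h1 := exp_neg_four_le hn
  have h2 : (1 : ℝ) / n ≤ 1 / 2 := one_div_le_one_div_of_le (by norm_num) (by linarith)
  have h3 := Real.exp_pos (-4)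
  nlinarith

/-- Isolation of two nodes is correlated by at most `O(1/n)`, which makes the variance of
`isolatedCount` linear in the number of uninformed nodes. -/
theorem isolated_pair_sub_sq_le (hn : 4 ≤ n) :
    (1 - 4 / n : ℝ) ^ n + 4 / n - isolatedProb n ^ 2 ≤ 6 / n := by
  have hn' : (4 : ℝ) ≤ n := by exact_mod_cast hn
  have h0 : (0 : ℝ) ≤ 1 - 2 / n := by
    rw [sub_nonneg, div_le_one (by linarith)]
    linarith
  have h1 : (1 - 4 / n : ℝ) ^ n ≤ ((1 - 2 / n : ℝ) ^ n) ^ 2 := by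
    rw [← pow_mul, mul_comm, pow_mul]
    apply pow_le_pow_left₀
    · rw [sub_nonneg, div_le_one (by linarith)]
      exact hn'
    · have : (1 - 2 / n : ℝ) ^ 2 = 1 - 4 / n + (2 / n) ^ 2 := by ring
      rw [this]
      nlinarith [sq_nonneg (2 / n : ℝ)]
  have h2 : (1 - 2 / n : ℝ) ^ n ≤ 1 := pow_le_one₀ h0 (by
    have : (0 : ℝ) ≤ 2 / n := by positivity
    linarith)
  have h3 : 0 ≤ (1 - 2 / n : ℝ) ^ n := pow_nonneg h0 n
  have h4 := le_isolatedProb hn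
  set b : ℝ := (1 - 2 / n : ℝ) ^ n
  have h5 : (1 : ℝ) / n ≤ 1 := by rw [div_le_one (by linarith)]; linarith
  have h6 : (1 - 2 / n) * b ^ 2 ≤ isolatedProb n ^ 2 := by
    have h7 : ((1 - 1 / n) * b) ^ 2 ≤ isolatedProb n ^ 2 :=
      pow_le_pow_left₀ (mul_nonneg (by linarith) h3) h4 2
    have h8 : ((1 - 1 / n) * b) ^ 2 = (1 - 2 / n) * b ^ 2 + (1 / n * b) ^ 2 := by ring
    nlinarith [sq_nonneg (1 / n * b)]
  have h9 : 2 / (n : ℝ) * b ^ 2 ≤ 2 / n :=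
    mul_le_of_le_one_right (by positivity) (pow_le_one₀ h3 h2)
  have h10 : 6 / (n : ℝ) = 4 / n + 2 / n := by ring
  linarith

/-- The number of nodes outside `I` that take part in no accepted call. -/
def isolatedCount (I : Finset (Fin n)) (a : Fin n → Option (Fin n)) : ℝ :=
  ∑ x ∈ Iᶜ, idle a x * rejected a x

theorem isolatedCount_le (I : Finset (Fin n)) (a : Fin n → Option (Fin n)) :
    isolatedCount I a ≤ n - (exchange I a).card := by
  rw [← card_compl_eq, isolatedCount]
  have h : ∀ x ∈ Iᶜ, idle a x * rejected a x ≤ if x ∈ (exchange I a)ᶜ then 1 else 0 := by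
    intro x hx
    split_ifs with h
    · exact mul_le_one₀ (idle_le_one a x) (rejected_nonneg a x) (rejected_le_one a x)
    · apply le_of_eq
      simp only [exchange, Finset.mem_compl, Finset.mem_filter, Finset.mem_univ, true_and,
        not_not] at h hx
      rcases h with h | ⟨z, y, h1, -, rfl | rfl⟩
      · exact absurd h hx
      · rw [rejected, if_pos ⟨y, h1⟩, mul_zero]
      · rw [idle, if_neg (by simp [h1]), zero_mul]
  refine (Finset.sum_le_sum h).trans ((Finset.sum_le_sum_of_subset_of_nonneg
    (Finset.subset_univ Iᶜ) fun x _ _ => ?_).trans ?_)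
  · split_ifs <;> norm_num
  · rw [Finset.sum_ite_mem, Finset.univ_inter]
    simp

theorem ev_isolatedCount (I : Finset (Fin n)) :
    ev (acceptLaw Finset.univ) (isolatedCount I) = (n - I.card) * isolatedProb n := by
  unfold isolatedCount
  rw [ev_sum]
  simp only [ev_idle_mul_rejected]
  rw [Finset.sum_const, nsmul_eq_mul, card_compl_eq]

theorem variance_isolatedCount_le (hn : 4 ≤ n) (I : Finset (Fin n)) :
    ev (acceptLaw Finset.univ)
      (fun a => (isolatedCount I a - (n - I.card) * isolatedProb n) ^ 2) ≤ 7 * (n - I.card) := by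
  have hn' : (4 : ℝ) ≤ n := by exact_mod_cast hn
  rw [ev_sq_sub, ev_isolatedCount]
  have h1 : ∀ a, isolatedCount I a ^ 2 = (∑ z ∈ Iᶜ.offDiag,
      idle a z.1 * rejected a z.1 * (idle a z.2 * rejected a z.2)) +
        ∑ x ∈ Iᶜ, (idle a x * rejected a x) ^ 2 := by
    intro a
    rw [sum_offDiag_mul Iᶜ fun x => idle a x * rejected a x, isolatedCount]
    ring
  simp only [h1]
  rw [ev_add, ev_sum]
  have h2 : ev (acceptLaw Finset.univ) (fun a => ∑ x ∈ Iᶜ, (idle a x * rejected a x) ^ 2) ≤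
      n - I.card := by
    rw [← card_compl_eq, ← ev_const (acceptLaw (Finset.univ : Finset (Fin n))) (Iᶜ.card : ℝ)]
    refine ev_mono _ fun a => ?_
    have h3 : ∀ x ∈ Iᶜ, (idle a x * rejected a x) ^ 2 ≤ 1 := fun x _ => by
      rw [mul_pow, sq_idle, sq_rejected]
      exact mul_le_one₀ (idle_le_one a x) (rejected_nonneg a x) (rejected_le_one a x)
    simpa using Finset.sum_le_card_nsmul _ _ _ h3
  have h3 := Finset.sum_le_card_nsmul Iᶜ.offDiag (fun z => ev (acceptLaw Finset.univ)
    (fun a => idle a z.1 * rejected a z.1 * (idle a z.2 * rejected a z.2)))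
    ((1 - 4 / n : ℝ) ^ n + 4 / n)
    (fun z hz => ev_isolated_pair_le hn (Finset.mem_offDiag.1 hz).2.2)
  rw [nsmul_eq_mul, Finset.offDiag_card, Nat.cast_sub (Nat.le_mul_self _)] at h3
  push_cast at h3
  rw [card_compl_eq] at h3
  have h4 := isolated_pair_sub_sq_le hn
  have hk := card_le_n I
  have hk0 : (0 : ℝ) ≤ I.card := by positivity
  have hp : 0 ≤ (1 - 4 / n : ℝ) ^ n + 4 / n := by
    have h0 : (0 : ℝ) ≤ 1 - 4 / n := by
      rw [sub_nonneg, div_le_one (by linarith)]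
      exact hn'
    positivity
  set p : ℝ := (1 - 4 / n : ℝ) ^ n + 4 / n
  set u : ℝ := n - (I.card : ℝ)
  have hu : 0 ≤ u := by simp only [u]; linarith
  have hun : u ≤ n := by simp only [u]; linarith
  have h5 : u ^ 2 * (p - isolatedProb n ^ 2) ≤ u ^ 2 * (6 / n) :=
    mul_le_mul_of_nonneg_left h4 (sq_nonneg u)
  have h6 : u ^ 2 * (6 / n) ≤ 6 * u := by
    rw [mul_div_assoc', div_le_iff₀ (by linarith)]
    nlinarith
  have h7 : (u * u - u) * p ≤ u ^ 2 * p := mul_le_mul_of_nonneg_right (by nlinarith) hp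
  nlinarith

/-! ### One push-pull round: the uninformed set does not collapse. -/

/-- Counts of uninformed nodes are only followed down to this threshold. -/
def threshold (n : ℕ) : ℝ := (n : ℝ) ^ (3 / 4 : ℝ)

/-- The logarithmic deficit of a count `x` of uninformed nodes, truncated at the threshold. -/
def deficit (n : ℕ) (x : ℝ) : ℝ := Real.log (n / max x (threshold n))

theorem threshold_pos (hn : 2 ≤ n) : 0 < threshold n := by
  have : (0 : ℝ) < n := by positivity
  exact Real.rpow_pos_of_pos this _

theorem threshold_pow_four (n : ℕ) : threshold n ^ 4 = (n : ℝ) ^ 3 := by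
  rw [threshold, ← Real.rpow_natCast, ← Real.rpow_mul (by positivity), ← Real.rpow_natCast]
  norm_num

theorem threshold_le (hn : 2 ≤ n) : threshold n ≤ n := by
  have : (2 : ℝ) ≤ n := by exact_mod_cast hn
  calc threshold n ≤ (n : ℝ) ^ (1 : ℝ) :=
        Real.rpow_le_rpow_of_exponent_le (by linarith) (by norm_num)
    _ = n := Real.rpow_one _

theorem deficit_nonneg (hn : 2 ≤ n) {x : ℝ} (hx : x ≤ n) : 0 ≤ deficit n x := by
  have h0 := threshold_pos hn
  apply Real.log_nonneg
  rw [le_div_iff₀ (lt_max_of_lt_right h0), one_mul]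
  exact max_le hx (threshold_le hn)

theorem deficit_anti (hn : 2 ≤ n) {x y : ℝ} (h : x ≤ y) : deficit n y ≤ deficit n x := by
  have h0 := threshold_pos hn
  have hn' : (2 : ℝ) ≤ n := by exact_mod_cast hn
  have h1 : 0 < max x (threshold n) := lt_max_of_lt_right h0
  have h2 : 0 < max y (threshold n) := lt_max_of_lt_right h0
  apply Real.log_le_log (by positivity)
  exact div_le_div_of_nonneg_left (by linarith) h1 (max_le_max_right _ h)

theorem deficit_le_log_div (hn : 2 ≤ n) {x y : ℝ} (hy : 0 < y) (h : y ≤ x) :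
    deficit n x ≤ Real.log (n / y) := by
  have hn' : (2 : ℝ) ≤ n := by exact_mod_cast hn
  have h1 : 0 < max x (threshold n) := lt_max_of_lt_right (threshold_pos hn)
  apply Real.log_le_log (by positivity)
  exact div_le_div_of_nonneg_left (by linarith) hy (le_max_of_le_left h)

theorem deficit_of_le_threshold {x : ℝ} (h : x ≤ threshold n) :
    deficit n x = Real.log (n / threshold n) := by
  rw [deficit, max_eq_right h]

theorem deficit_of_threshold_le {x : ℝ} (h : threshold n ≤ x) :
    deficit n x = Real.log (n / x) := by
  rw [deficit, max_eq_left h]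

theorem deficit_le_max (hn : 2 ≤ n) (x : ℝ) : deficit n x ≤ Real.log (n / threshold n) := by
  rw [← deficit_of_le_threshold (le_refl (threshold n))]
  rcases le_total x (threshold n) with h | h
  · rw [deficit_of_le_threshold h, deficit_of_le_threshold le_rfl]
  · exact deficit_anti hn h

theorem log_div_threshold_le (hn : 2 ≤ n) : Real.log (n / threshold n) ≤ threshold n := by
  have h0 := threshold_pos hn
  have hn' : (2 : ℝ) ≤ n := by exact_mod_cast hn
  refine (Real.log_le_self (by positivity)).trans ?_
  rw [div_le_iff₀ h0, ← pow_two]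
  have h1 := threshold_pow_four n
  have h2 : (n : ℝ) ^ 2 ≤ (threshold n ^ 2) ^ 2 := by
    rw [← pow_mul, h1]
    nlinarith [sq_nonneg (n : ℝ)]
  exact le_of_sq_le_sq h2 (by positivity)

/-- A bound for the growth of the deficit per push-pull round, relative to the informed part. -/
def deficitRate : ℝ :=
  6 + 6 * (Real.log (4 * Real.exp 4) + 112 * Real.exp 8)

theorem ev_deficit_pushPull_le (hn : 4 ≤ n) {I : Finset (Fin n)} (hI : I.Nonempty) :
    ev (roundLaw Finset.univ I) (fun S => deficit n (n - S.card)) ≤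
      deficit n (n - I.card) + deficitRate * (I.card / n) := by
  have hn' : (4 : ℝ) ≤ n := by exact_mod_cast hn
  have hn2 : 2 ≤ n := by omega
  have hk1 : (1 : ℝ) ≤ I.card := by exact_mod_cast hI.card_pos
  have hk := card_le_n I
  have hvar := variance_isolatedCount_le hn I
  have hp := exp_neg_four_half_le hn
  have hM := threshold_pos hn2
  have hlog4 : 0 ≤ Real.log (4 * Real.exp 4) := by
    apply Real.log_nonneg
    have := Real.one_le_exp (show (0 : ℝ) ≤ 4 by norm_num)
    linarith
  rw [ev_roundLaw]
  set k : ℝ := (I.card : ℝ) with hkdef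
  have hd0 : 0 ≤ deficit n (n - k) := deficit_nonneg hn2 (by linarith)
  have hkn0 : 0 ≤ k / n := by positivity
  -- With few informed nodes, tripling already bounds the new deficit by `6 k/n`. Otherwise `k/n >
  -- 1/6`, so any bounded expected increase is affordable.
  rcases le_or_gt (6 * k) n with h6 | h6
  · rw [← ev_const (acceptLaw (Finset.univ : Finset (Fin n)))
      (deficit n (n - k) + deficitRate * (k / n))]
    refine ev_mono_support _ fun a ha => ?_
    have h1 := card_exchange_le (isInjAccept_of_mem_support ha) I
    rw [← hkdef] at h1
    have h2 : deficit n (n - (exchange I a).card) ≤ Real.log (n / (n - 3 * k)) :=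
      deficit_le_log_div hn2 (by linarith) (by linarith)
    have h3 : Real.log (n / (n - 3 * k)) ≤ n / (n - 3 * k) - 1 :=
      Real.log_le_sub_one_of_pos (div_pos (by linarith) (by linarith))
    have h4 : n / (n - 3 * k) - 1 ≤ 6 * (k / n) := by
      have : (n : ℝ) - 3 * k ≠ 0 := by linarith
      have h5 : n / (n - 3 * k) - 1 = 3 * k / (n - 3 * k) := by
        field_simp
        ring
      rw [h5, mul_div_assoc', div_le_div_iff₀ (by linarith) (by linarith)]
      nlinarith
    have h5 : 6 * (k / n) ≤ deficitRate * (k / n) := by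
      apply mul_le_mul_of_nonneg_right _ hkn0
      have := Real.exp_pos 8
      rw [deficitRate]
      linarith
    linarith
  · have hrate : Real.log (4 * Real.exp 4) + 112 * Real.exp 8 ≤ deficitRate * (k / n) := by
      have h1 : 1 / 6 ≤ k / n := by
        rw [div_le_div_iff₀ (by norm_num) (by linarith)]
        linarith
      have := Real.exp_pos 8
      rw [deficitRate]
      nlinarith
    rcases le_or_gt (n - k) (threshold n) with hu | hu
    · rw [deficit_of_le_threshold hu]
      have h1 : ev (acceptLaw Finset.univ) (fun a => deficit n (n - (exchange I a).card)) ≤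
          Real.log (n / threshold n) := by
        rw [← ev_const (acceptLaw (Finset.univ : Finset (Fin n))) (Real.log (n / threshold n))]
        exact ev_mono _ fun a => deficit_le_max hn2 _
      have := Real.exp_pos 8
      linarith
    · set u : ℝ := n - k with hudef
      have hu0 : 0 < u := hM.trans hu
      set L : ℝ := Real.log (n / threshold n) with hL
      have hL0 : 0 ≤ L := by
        apply Real.log_nonneg
        rw [le_div_iff₀ hM, one_mul]
        exact threshold_le hn2
      have hpt : ∀ a, deficit n (n - (exchange I a).card) ≤
          (deficit n u + Real.log (4 * Real.exp 4)) + (16 * Real.exp 8 * L / u ^ 2) *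
            (isolatedCount I a - u * isolatedProb n) ^ 2 := by
        intro a
        have hN := isolatedCount_le I a
        set N := isolatedCount I a
        have hlast : 0 ≤ (16 * Real.exp 8 * L / u ^ 2) * (N - u * isolatedProb n) ^ 2 := by
          positivity
        -- The mean of `N` is at least `exp (-4) / 2 * u`. If `N` reaches half of that, the deficit
        -- rises by at most a constant; if not, the maximal deficit `L` is charged to the squared
        -- deviation, as in Chebyshev's inequality.
        rcases le_or_gt (Real.exp (-4) / 4 * u) N with hc | hc
        · have h1 : deficit n (n - (exchange I a).card) ≤
              Real.log (n / (Real.exp (-4) / 4 * u)) :=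
            deficit_le_log_div hn2 (by positivity) (hc.trans hN)
          have h2 : (n : ℝ) / (Real.exp (-4) / 4 * u) = n / u * (4 * Real.exp 4) := by
            rw [Real.exp_neg]
            field_simp
          rw [h2, Real.log_mul (by positivity) (by positivity),
            ← deficit_of_threshold_le hu.le] at h1
          linarith
        · have h1 : deficit n (n - (exchange I a).card) ≤ L := deficit_le_max hn2 _
          have h2 : Real.exp (-4) / 4 * u ≤ u * isolatedProb n - N := by nlinarith
          have h3 : (Real.exp (-4) / 4 * u) ^ 2 ≤ (N - u * isolatedProb n) ^ 2 := by
            rw [← neg_sq (N - u * isolatedProb n), neg_sub]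
            exact pow_le_pow_left₀ (by positivity) h2 2
          have h4 : L ≤ (16 * Real.exp 8 * L / u ^ 2) * (N - u * isolatedProb n) ^ 2 := by
            calc L = (16 * Real.exp 8 * L / u ^ 2) * (Real.exp (-4) / 4 * u) ^ 2 := by
                  have : Real.exp (-4) ^ 2 * Real.exp 8 = 1 := by
                    rw [← Real.exp_nat_mul, ← Real.exp_add]
                    norm_num
                  field_simp
                  linear_combination (-16 * L) * this
              _ ≤ _ := mul_le_mul_of_nonneg_left h3 (by positivity)
          have h5 : 0 ≤ deficit n u := hd0
          linarith
      refine (ev_mono _ hpt).trans ?_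
      rw [ev_add, ev_const, ev_mul]
      have h1 : (16 * Real.exp 8 * L / u ^ 2) * ev (acceptLaw Finset.univ)
          (fun a => (isolatedCount I a - u * isolatedProb n) ^ 2) ≤ 112 * Real.exp 8 := by
        calc _ ≤ (16 * Real.exp 8 * L / u ^ 2) * (7 * u) :=
              mul_le_mul_of_nonneg_left hvar (by positivity)
          _ = 112 * Real.exp 8 * (L / u) := by
              field_simp
              ring
          _ ≤ 112 * Real.exp 8 * 1 := by
              refine mul_le_mul_of_nonneg_left ?_ (by positivity)
              rw [div_le_one hu0]
              exact (log_div_threshold_le hn2).trans hu.le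
          _ = 112 * Real.exp 8 := mul_one _
      linarith


/-! ### One pull round: moments. -/

/-- The number of nodes of `I` that accept a call. -/
def busyCount (I : Finset (Fin n)) (a : Fin n → Option (Fin n)) : ℝ := ∑ y ∈ I, (1 - idle a y)

/-- The probability that a given node receives a call when the nodes outside `I` call. -/
def busyProb (I : Finset (Fin n)) : ℝ := 1 - (1 - 1 / n : ℝ) ^ Iᶜ.card

theorem ev_busyCount (I : Finset (Fin n)) :
    ev (acceptLaw Iᶜ) (busyCount I) = I.card * busyProb I := by
  unfold busyCount
  rw [ev_sum]
  simp only [ev_sub, ev_const, ev_idle]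
  rw [Finset.sum_const, nsmul_eq_mul, busyProb]

theorem one_sub_inv_nonneg (hn : 2 ≤ n) : (0 : ℝ) ≤ 1 - 1 / n := by
  have : (2 : ℝ) ≤ n := by exact_mod_cast hn
  rw [sub_nonneg, div_le_one (by linarith)]
  linarith

theorem busyProb_nonneg (hn : 2 ≤ n) (I : Finset (Fin n)) : 0 ≤ busyProb I := by
  rw [busyProb, sub_nonneg]
  apply pow_le_one₀ (one_sub_inv_nonneg hn)
  have : (0 : ℝ) ≤ 1 / n := by positivity
  linarith

theorem busyProb_le (hn : 2 ≤ n) (I : Finset (Fin n)) : busyProb I ≤ (n - I.card) / n := by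
  have h0 := one_sub_inv_nonneg hn
  have h := one_add_mul_le_pow (a := -(1 / n : ℝ)) (by linarith) Iᶜ.card
  rw [card_compl_eq] at h
  have h1 : (1 : ℝ) + -(1 / n) = 1 - 1 / n := by ring
  have h2 : (n - (I.card : ℝ)) / n = (n - I.card) * (1 / n) := by ring
  rw [h1] at h
  rw [busyProb, h2]
  linarith

theorem one_sub_exp_neg_le_busyProb (hn : 2 ≤ n) (I : Finset (Fin n)) :
    1 - Real.exp (-((n - I.card) / n)) ≤ busyProb I := by
  have h1 : (1 - 1 / n : ℝ) ≤ Real.exp (-(1 / n)) := by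
    have := Real.add_one_le_exp (-(1 / n : ℝ))
    linarith
  have h2 := pow_le_pow_left₀ (one_sub_inv_nonneg hn) h1 Iᶜ.card
  rw [← Real.exp_nat_mul, card_compl_eq] at h2
  have h3 : (n - (I.card : ℝ)) * -(1 / n) = -((n - I.card) / n) := by ring
  rw [h3] at h2
  rw [busyProb]
  linarith

theorem exp_neg_le_quadratic {x : ℝ} (hx : 0 ≤ x) : Real.exp (-x) ≤ 1 - x + x ^ 2 / 2 := by
  have h1 := Real.quadratic_le_exp_of_nonneg hx
  have h2 : 0 < 1 + x + x ^ 2 / 2 := by positivity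
  rw [Real.exp_neg, inv_le_comm₀ (Real.exp_pos x) (by nlinarith [sq_nonneg (x - 1)])]
  refine le_trans ?_ h1
  -- The product `(1 - x + x^2/2) (1 + x + x^2/2)` equals `1 + x^4/4`.
  rw [inv_le_iff_one_le_mul₀ (by nlinarith [sq_nonneg (x - 1)])]
  nlinarith [sq_nonneg (x ^ 2)]

theorem le_busyProb (hn : 2 ≤ n) (I : Finset (Fin n)) :
    (n - I.card) / n - ((n - I.card) / n) ^ 2 / 2 ≤ busyProb I := by
  have hn' : (2 : ℝ) ≤ n := by exact_mod_cast hn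
  have hx : 0 ≤ (n - (I.card : ℝ)) / n := div_nonneg (by linarith [card_le_n I]) (by linarith)
  have h1 := one_sub_exp_neg_le_busyProb hn I
  have h2 := exp_neg_le_quadratic hx
  linarith

theorem ev_card_pull (I : Finset (Fin n)) :
    ev (roundLaw Iᶜ I) (fun S => (S.card : ℝ)) = I.card + I.card * busyProb I := by
  rw [ev_roundLaw, ev_congr_support _ fun a ha => card_exchange_pull ha, ev_add, ev_const,
    ← ev_busyCount]
  rfl

/-- This quadratic shrinking of the uninformed set is the source of the term `log_2 ln n`. -/
theorem ev_uninformed_pull_le (hn : 2 ≤ n) (I : Finset (Fin n)) :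
    ev (roundLaw Iᶜ I) (fun S => (n : ℝ) - S.card) ≤ 3 / 2 * (n - I.card) ^ 2 / n := by
  have hn' : (2 : ℝ) ≤ n := by exact_mod_cast hn
  have hk := card_le_n I
  have hk0 : (0 : ℝ) ≤ I.card := by positivity
  have h1 := le_busyProb hn I
  rw [ev_sub, ev_const, ev_card_pull]
  have h2 : (I.card : ℝ) = n - (n - I.card) := by ring
  set u : ℝ := n - (I.card : ℝ) with hu
  have hu0 : 0 ≤ u := by linarith
  have h3 : (I.card : ℝ) * (u / n - (u / n) ^ 2 / 2) ≤ I.card * busyProb I :=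
    mul_le_mul_of_nonneg_left h1 hk0
  have h4 : (n : ℝ) - (I.card + I.card * (u / n - (u / n) ^ 2 / 2)) =
      3 / 2 * u ^ 2 / n - u * (u / n) ^ 2 / 2 := by
    rw [h2]
    field_simp
    ring
  have h5 : 0 ≤ u * (u / n) ^ 2 / 2 := by positivity
  linarith

theorem variance_busyCount_le (I : Finset (Fin n)) :
    ev (acceptLaw Iᶜ) (fun a => (busyCount I a - I.card * busyProb I) ^ 2) ≤
      I.card * busyProb I := by
  rw [ev_sq_sub, ev_busyCount]
  have h1 : ∀ a, busyCount I a ^ 2 = (∑ z ∈ I.offDiag, (1 - idle a z.1) * (1 - idle a z.2)) +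
      busyCount I a := by
    intro a
    rw [sum_offDiag_mul I fun x => 1 - idle a x, busyCount]
    have : ∀ x, (1 - idle a x) ^ 2 = 1 - idle a x := fun x => by
      have := sq_idle a x
      linear_combination this
    simp only [this]
    ring
  simp only [h1]
  rw [ev_add, ev_busyCount, ev_sum]
  have h3 := Finset.sum_le_card_nsmul I.offDiag
    (fun z => ev (acceptLaw Iᶜ) (fun a => (1 - idle a z.1) * (1 - idle a z.2)))
    (busyProb I ^ 2) (fun z hz => ev_not_idle_mul_le Iᶜ (Finset.mem_offDiag.1 hz).2.2)
  rw [nsmul_eq_mul, Finset.offDiag_card, Nat.cast_sub (Nat.le_mul_self _)] at h3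
  push_cast at h3
  have h4 : 0 ≤ (I.card : ℝ) * busyProb I ^ 2 := by positivity
  nlinarith

/-- With `b ≤ k` new nodes the logarithm gains at least `b/(2 k)`, with mean `busyProb I / 2`. The
assumption gives `busyProb I ≥ 1 - exp (-1/16) ≥ 1/17`. -/
theorem ev_log_card_pull_le (hn : 2 ≤ n) {I : Finset (Fin n)} (hI : I.Nonempty)
    (hu : (n : ℝ) / 16 ≤ n - I.card) :
    ev (roundLaw Iᶜ I) (fun S => Real.log (n / S.card)) ≤ Real.log (n / I.card) - 1 / 34 := by
  have hn' : (2 : ℝ) ≤ n := by exact_mod_cast hn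
  have hk1 : (1 : ℝ) ≤ I.card := by exact_mod_cast hI.card_pos
  have hq := one_sub_exp_neg_le_busyProb hn I
  rw [ev_roundLaw]
  have hpt : ∀ a ∈ (acceptLaw Iᶜ).support, Real.log (n / (exchange I a).card) ≤
      Real.log (n / I.card) - 1 / (2 * I.card) * busyCount I a := by
    intro a ha
    have h1 := card_exchange_pull ha
    have h2 : busyCount I a ≤ I.card := by
      have : ∀ y ∈ I, 1 - idle a y ≤ 1 := fun y _ => by linarith [idle_nonneg a y]
      simpa [busyCount] using Finset.sum_le_card_nsmul _ _ _ this
    have h3 : 0 ≤ busyCount I a :=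
      Finset.sum_nonneg fun y _ => by linarith [idle_le_one a y]
    rw [h1]
    change Real.log (n / ((I.card : ℝ) + busyCount I a)) ≤ _
    set k : ℝ := (I.card : ℝ)
    set b := busyCount I a
    rw [Real.log_div (by linarith) (by linarith), Real.log_div (by linarith) (by linarith)]
    have h4 := Real.one_sub_inv_le_log_of_pos (show 0 < (k + b) / k by positivity)
    rw [Real.log_div (by linarith) (by linarith)] at h4
    have h5 : 1 / (2 * k) * b ≤ 1 - ((k + b) / k)⁻¹ := by
      have h6 : 1 - ((k + b) / k)⁻¹ = b / (k + b) := by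
        have : k + b ≠ 0 := by linarith
        field_simp
        ring
      rw [h6, one_div_mul_eq_div]
      exact div_le_div_of_nonneg_left h3 (by linarith) (by linarith)
    linarith
  refine (ev_mono_support _ hpt).trans ?_
  rw [ev_sub, ev_const, ev_mul, ev_busyCount]
  have h1 : 1 / (2 * (I.card : ℝ)) * (I.card * busyProb I) = busyProb I / 2 := by
    field_simp
  rw [h1]
  have h2 : (1 : ℝ) / 16 ≤ (n - I.card) / n := by
    rw [div_le_div_iff₀ (by norm_num) (by linarith)]
    linarith
  have h3 : Real.exp (-((n - (I.card : ℝ)) / n)) ≤ 16 / 17 := by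
    refine (Real.exp_le_exp.2 (neg_le_neg h2)).trans ?_
    rw [Real.exp_neg, inv_le_comm₀ (Real.exp_pos _) (by norm_num)]
    have := Real.add_one_le_exp (1 / 16 : ℝ)
    norm_num at this ⊢
    linarith
  linarith

/-! ### Upper potential for the pull phase. -/

/-- With `A = log (c/m)` and `B = log (c/x)` this is the tangent line at `m` of `x ↦ -log (log
(c/x))`, which is concave where `log (c/x) ≥ 1`. -/
theorem log_sub_log_le {A B : ℝ} (hA : 2 ≤ A) (hB : 2 ≤ B) :
    Real.log A - Real.log B ≤ (Real.exp (A - B) - 1) / A := by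
  rcases le_total B A with h | h
  · have h1 := Real.log_le_sub_one_of_pos (show 0 < A / B by positivity)
    rw [Real.log_div (by linarith) (by linarith)] at h1
    refine h1.trans ?_
    have h2 : A / B - 1 = (A - B) / B := by field_simp
    rw [h2, div_le_div_iff₀ (by linarith) (by linarith)]
    have h3 := Real.quadratic_le_exp_of_nonneg (sub_nonneg.2 h)
    have h4 : 0 ≤ (A - B) ^ 2 * (B - 2) := mul_nonneg (sq_nonneg _) (by linarith)
    calc (A - B) * A ≤ ((A - B) + (A - B) ^ 2 / 2) * B := by linarith
      _ ≤ (Real.exp (A - B) - 1) * B :=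
        mul_le_mul_of_nonneg_right (by linarith) (by linarith)
  · set r := B - A with hr
    have hr0 : 0 ≤ r := by linarith
    have h1 := Real.le_log_one_add_of_nonneg (show 0 ≤ r / A by positivity)
    have h2 : 1 + r / A = B / A := by
      rw [hr]
      field_simp
      ring
    rw [h2, Real.log_div (by linarith) (by linarith)] at h1
    have h3 : 2 * (r / A) / (r / A + 2) = 2 * r / (2 * A + r) := by
      field_simp
      ring
    rw [h3] at h1
    have h4 : A - B = -r := by rw [hr]; ring
    rw [h4]
    have h5 : (1 - Real.exp (-r)) / A ≤ 2 * r / (2 * A + r) := by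
      rw [div_le_div_iff₀ (by linarith) (by linarith)]
      rcases le_total r 2 with h6 | h6
      · have h7 : (1 - r / 2) ^ 2 ≤ Real.exp (-r) := by
          have h8 := Real.add_one_le_exp (-(r / 2))
          have h9 : Real.exp (-r) = Real.exp (-(r / 2)) ^ 2 := by
            rw [← Real.exp_nat_mul]
            congr 1
            push_cast
            ring
          rw [h9]
          exact pow_le_pow_left₀ (by linarith) (by linarith) 2
        have h10 : (1 - Real.exp (-r)) * (2 * A + r) ≤ (r - r ^ 2 / 4) * (2 * A + r) :=
          mul_le_mul_of_nonneg_right (by nlinarith) (by linarith)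
        have h11 : 0 ≤ r ^ 2 * (A - 2) := mul_nonneg (sq_nonneg _) (by linarith)
        have h12 : 0 ≤ r ^ 3 := by positivity
        nlinarith
      · have h7 := Real.exp_pos (-r)
        have h8 : (1 - Real.exp (-r)) * (2 * A + r) ≤ 1 * (2 * A + r) :=
          mul_le_mul_of_nonneg_right (by linarith) (by linarith)
        nlinarith
    have h6 : (Real.exp (-r) - 1) / A = -((1 - Real.exp (-r)) / A) := by ring
    rw [h6]
    linarith

/-- An upper bound for the time that pulls need to inform the last `x` nodes. -/
def tailTime (n : ℕ) (x : ℝ) : ℝ :=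
  if x < 1 then 0
  else 4 + (Real.log (Real.log (8 * n)) - Real.log (Real.log (max (n / (2 * x)) 8))) / Real.log 2

theorem two_lt_log_eight : 2 < Real.log 8 := by
  have h : (8 : ℝ) = 2 ^ 3 := by norm_num
  rw [h, Real.log_pow]
  have := Real.log_two_gt_d9
  push_cast
  linarith

theorem two_lt_log_max (y : ℝ) : 2 < Real.log (max y 8) :=
  two_lt_log_eight.trans_le (Real.log_le_log (by norm_num) (le_max_right _ _))

theorem log_two_pos : 0 < Real.log 2 := Real.log_pos (by norm_num)

/-- The jump to at least 4 at one uninformed node pays for the last stage: a factor `3/4` then means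
a loss of at least 1. -/
theorem four_le_tailTime (hn : 2 ≤ n) {x : ℝ} (hx : 1 ≤ x) : 4 ≤ tailTime n x := by
  have hn' : (2 : ℝ) ≤ n := by exact_mod_cast hn
  rw [tailTime, if_neg (not_lt.2 hx)]
  have h1 : max (n / (2 * x)) 8 ≤ 8 * (n : ℝ) := by
    apply max_le
    · rw [div_le_iff₀ (by linarith)]
      nlinarith
    · linarith
  have h2 := two_lt_log_max (n / (2 * x))
  have h3 : Real.log (Real.log (max (n / (2 * x)) 8)) ≤ Real.log (Real.log (8 * n)) :=
    Real.log_le_log (by linarith) (Real.log_le_log (by positivity) h1)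
  have h4 : 0 ≤ (Real.log (Real.log (8 * n)) - Real.log (Real.log (max (n / (2 * x)) 8))) /
      Real.log 2 := div_nonneg (by linarith) log_two_pos.le
  linarith

theorem tailTime_nonneg (hn : 2 ≤ n) (x : ℝ) : 0 ≤ tailTime n x := by
  rcases lt_or_ge x 1 with h | h
  · rw [tailTime, if_pos h]
  · linarith [four_le_tailTime hn h]

theorem tailTime_mono (hn : 2 ≤ n) {x y : ℝ} (h : x ≤ y) : tailTime n x ≤ tailTime n y := by
  have hn' : (2 : ℝ) ≤ n := by exact_mod_cast hn
  rcases lt_or_ge x 1 with hx | hx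
  · rw [tailTime, if_pos hx]
    exact tailTime_nonneg hn y
  · rw [tailTime, tailTime, if_neg (not_lt.2 hx), if_neg (not_lt.2 (hx.trans h))]
    have h1 : max ((n : ℝ) / (2 * y)) 8 ≤ max (n / (2 * x)) 8 :=
      max_le_max_right _ (div_le_div_of_nonneg_left (by linarith) (by linarith) (by linarith))
    have h2 := two_lt_log_max (n / (2 * y))
    have h3 : Real.log (Real.log (max (n / (2 * y)) 8)) ≤
        Real.log (Real.log (max (n / (2 * x)) 8)) :=
      Real.log_le_log (by linarith) (Real.log_le_log (by positivity) h1)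
    have h4 : (Real.log (Real.log (8 * n)) - Real.log (Real.log (max (n / (2 * x)) 8))) /
        Real.log 2 ≤ (Real.log (Real.log (8 * n)) - Real.log (Real.log (max (n / (2 * y)) 8))) /
        Real.log 2 := div_le_div_of_nonneg_right (by linarith) log_two_pos.le
    linarith

theorem tailTime_le (hn : 2 ≤ n) (x : ℝ) : tailTime n x ≤ 6 + Real.logb 2 (Real.log n) := by
  have hn' : (2 : ℝ) ≤ n := by exact_mod_cast hn
  have hl0 : Real.log 2 ≤ Real.log n := Real.log_le_log (by norm_num) hn'
  have hln : 0 < Real.log n := log_two_pos.trans_le hl0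
  have h8 : Real.log (Real.log (8 * n)) ≤ 2 * Real.log 2 + Real.log (Real.log n) := by
    have h1 : Real.log (8 * n) ≤ 2 ^ 2 * Real.log n := by
      rw [Real.log_mul (by norm_num) (by linarith), show (8 : ℝ) = 2 ^ 3 by norm_num,
        Real.log_pow]
      push_cast
      linarith
    have h2 : 0 < Real.log (8 * n) := Real.log_pos (by linarith)
    calc _ ≤ Real.log (2 ^ 2 * Real.log n) := Real.log_le_log h2 h1
      _ = 2 * Real.log 2 + Real.log (Real.log n) := by
        rw [Real.log_mul (by norm_num) hln.ne', Real.log_pow]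
        push_cast
        ring
  have hlow : -1 ≤ Real.logb 2 (Real.log n) := by
    rw [Real.logb, le_div_iff₀ log_two_pos]
    have h1 : Real.log (Real.log 2) ≤ Real.log (Real.log n) := Real.log_le_log log_two_pos hl0
    have h2 : Real.log (1 / 2) ≤ Real.log (Real.log 2) :=
      Real.log_le_log (by norm_num) (by linarith [Real.log_two_gt_d9])
    rw [one_div, Real.log_inv] at h2
    linarith
  rcases lt_or_ge x 1 with h | h
  · rw [tailTime, if_pos h]
    linarith
  · rw [tailTime, if_neg (not_lt.2 h)]
    have h3 : 0 ≤ Real.log (Real.log (max (n / (2 * x)) 8)) :=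
      Real.log_nonneg (by linarith [two_lt_log_max (n / (2 * x))])
    have h4 : (Real.log (Real.log (8 * n)) - Real.log (Real.log (max (n / (2 * x)) 8))) /
        Real.log 2 ≤ (2 * Real.log 2 + Real.log (Real.log n)) / Real.log 2 :=
      div_le_div_of_nonneg_right (by linarith) log_two_pos.le
    have h5 : (2 * Real.log 2 + Real.log (Real.log n)) / Real.log 2 =
        2 + Real.logb 2 (Real.log n) := by
      rw [Real.logb, add_div, mul_div_cancel_right₀ _ log_two_pos.ne']
    linarith

/-- The tangent bound permits a Jensen-type estimate from the mean alone. For `x < 1` the jump in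
`tailTime` leaves ample room. -/
theorem tailTime_tangent (hn : 2 ≤ n) {x m : ℝ} (hx : x < 1 ∧ 0 ≤ x ∨ 1 ≤ x) (hm : 1 ≤ m)
    (hxn : 16 * x ≤ n) (hmn : 16 * m ≤ n) :
    tailTime n x ≤ tailTime n m + (x / m - 1) / (Real.log (n / (2 * m)) * Real.log 2) := by
  have hn' : (2 : ℝ) ≤ n := by exact_mod_cast hn
  have h8m : 8 ≤ n / (2 * m) := by
    rw [le_div_iff₀ (by linarith)]
    linarith
  have hA : 2 ≤ Real.log (n / (2 * m)) :=
    two_lt_log_eight.le.trans (Real.log_le_log (by norm_num) h8m)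
  have hl2 := log_two_pos
  set A := Real.log (n / (2 * m)) with hAdef
  rcases hx with ⟨hx, hx0⟩ | hx
  · have h1 := four_le_tailTime hn hm
    rw [tailTime, if_pos hx]
    have h2 : -1 ≤ (x / m - 1) / (A * Real.log 2) := by
      rw [le_div_iff₀ (by positivity)]
      have : 0 ≤ x / m := by positivity
      have h3 := Real.log_two_gt_d9
      nlinarith
    linarith
  · have h8x : 8 ≤ n / (2 * x) := by
      rw [le_div_iff₀ (by linarith)]
      linarith
    have hB : 2 ≤ Real.log (n / (2 * x)) :=
      two_lt_log_eight.le.trans (Real.log_le_log (by norm_num) h8x)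
    rw [tailTime, tailTime, if_neg (not_lt.2 hx), if_neg (not_lt.2 hm), max_eq_left h8x,
      max_eq_left h8m, ← hAdef]
    have h1 := log_sub_log_le hA hB
    have h2 : Real.exp (A - Real.log (n / (2 * x))) = x / m := by
      rw [hAdef, Real.exp_sub, Real.exp_log (by positivity), Real.exp_log (by positivity)]
      field_simp
    rw [h2] at h1
    have h3 : (x / m - 1) / (A * Real.log 2) = (x / m - 1) / A / Real.log 2 := by
      rw [div_div]
    rw [h3, add_assoc, ← add_div]
    have h4 := div_le_div_of_nonneg_right (c := Real.log 2)
      (show Real.log (Real.log (8 * n)) - Real.log (Real.log (n / (2 * x))) ≤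
        Real.log (Real.log (8 * n)) - Real.log A + (x / m - 1) / A by linarith) hl2.le
    linarith

theorem uninformed_dichotomy (S : Finset (Fin n)) :
    (S.card : ℝ) = n ∨ (1 : ℝ) ≤ n - S.card := by
  have h := Finset.card_le_univ S
  rw [Fintype.card_fin] at h
  rcases h.eq_or_lt with h | h
  · left
    exact_mod_cast h
  · right
    have : (S.card : ℝ) + 1 ≤ n := by exact_mod_cast h
    linarith

theorem ev_tailTime_pull_le (hn : 2 ≤ n) {I : Finset (Fin n)} (hI : (1 : ℝ) ≤ n - I.card)
    (hu : 16 * (n - I.card : ℝ) ≤ n) :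
    ev (roundLaw Iᶜ I) (fun S => tailTime n (n - S.card)) ≤ tailTime n (n - I.card) - 1 := by
  have hn' : (2 : ℝ) ≤ n := by exact_mod_cast hn
  have hmean := ev_uninformed_pull_le hn I
  have hW := four_le_tailTime hn hI
  have hsub : ∀ S ∈ (roundLaw Iᶜ I).support, (n : ℝ) - S.card ≤ n - I.card := by
    intro S hS
    have : (I.card : ℝ) ≤ S.card := by
      exact_mod_cast Finset.card_le_card (subset_of_mem_support_roundLaw hS)
    linarith
  set u : ℝ := n - (I.card : ℝ)
  -- If `2 u^2/n < 1`, the expected number of uninformed nodes is at most `3/4`, and since this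
  -- number is an integer it may multiply `tailTime n u`. Otherwise the tangent at `m = 2 u^2/n`,
  -- which exceeds the mean, is used.
  rcases lt_or_ge (2 * u ^ 2 / n) 1 with hm | hm
  · have hpt : ∀ S ∈ (roundLaw Iᶜ I).support,
        tailTime n (n - S.card) ≤ tailTime n u * (n - S.card) := by
      intro S hS
      rcases uninformed_dichotomy S with h | h
      · rw [h, sub_self, mul_zero, tailTime, if_pos (by norm_num)]
      · have h1 := tailTime_mono hn (hsub S hS)
        nlinarith
    refine (ev_mono_support _ hpt).trans ?_
    rw [ev_mul]
    have h2 : 3 / 2 * u ^ 2 / n ≤ 3 / 4 := by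
      have : 3 / 2 * u ^ 2 / n = 3 / 4 * (2 * u ^ 2 / n) := by ring
      rw [this]
      linarith
    nlinarith
  · set m : ℝ := 2 * u ^ 2 / n with hmdef
    have hmu : m ≤ u := by
      rw [hmdef, div_le_iff₀ (by linarith)]
      nlinarith
    have hpt : ∀ S ∈ (roundLaw Iᶜ I).support, tailTime n (n - S.card) ≤
        tailTime n m - 1 / (Real.log (n / (2 * m)) * Real.log 2) +
          1 / (m * (Real.log (n / (2 * m)) * Real.log 2)) * (n - S.card) := by
      intro S hS
      have h1 : (n : ℝ) - S.card < 1 ∧ 0 ≤ (n : ℝ) - S.card ∨ 1 ≤ (n : ℝ) - S.card := by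
        rcases uninformed_dichotomy S with h | h
        · left
          rw [h]
          norm_num
        · exact Or.inr h
      have h2 := tailTime_tangent hn h1 hm (by linarith [hsub S hS]) (by linarith)
      refine h2.trans (le_of_eq ?_)
      rw [sub_div, div_div, one_div_mul_eq_div]
      ring
    refine (ev_mono_support _ hpt).trans ?_
    rw [ev_add, ev_const, ev_mul]
    have hu0 : 0 < u := by linarith
    have h8u : 8 ≤ n / (2 * u) := by
      rw [le_div_iff₀ (by linarith)]
      linarith
    have h8m : 8 ≤ n / (2 * m) := by
      rw [le_div_iff₀ (by linarith)]
      linarith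
    -- The choice of `m` squares `n/(2 u)`, so the inner logarithm doubles and `tailTime` falls by
    -- exactly one.
    have hsq : n / (2 * m) = (n / (2 * u)) ^ 2 := by
      rw [hmdef]
      field_simp
    have hA : 2 < Real.log (n / (2 * m)) :=
      two_lt_log_eight.trans_le (Real.log_le_log (by norm_num) h8m)
    have hB : 2 < Real.log (n / (2 * u)) :=
      two_lt_log_eight.trans_le (Real.log_le_log (by norm_num) h8u)
    have hWm : tailTime n m = tailTime n u - 1 := by
      have h1 : Real.log (Real.log ((n / (2 * u)) ^ 2)) =
          Real.log 2 + Real.log (Real.log (n / (2 * u))) := by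
        rw [Real.log_pow, Nat.cast_ofNat, Real.log_mul (by norm_num) (by linarith)]
      rw [tailTime, tailTime, if_neg (not_lt.2 hm), if_neg (not_lt.2 hI), max_eq_left h8u,
        max_eq_left h8m, hsq, h1]
      have := log_two_pos
      generalize Real.log (Real.log (8 * n)) = p
      generalize Real.log (Real.log (n / (2 * u))) = q
      field_simp
      ring
    have hD : 0 < Real.log (n / (2 * m)) * Real.log 2 := mul_pos (by linarith) log_two_pos
    set D := Real.log (n / (2 * m)) * Real.log 2
    have h3 : 1 / (m * D) * ev (roundLaw Iᶜ I) (fun S => (n : ℝ) - S.card) ≤ 1 / D := by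
      calc _ ≤ 1 / (m * D) * m := by
            refine mul_le_mul_of_nonneg_left (hmean.trans ?_) (by positivity)
            rw [hmdef]
            apply div_le_div_of_nonneg_right _ (by linarith)
            nlinarith
        _ = 1 / D := by field_simp
    linarith

/-- An upper bound for the expected remaining time of the pull phase. -/
def pullTime (S : Finset (Fin n)) : ℝ :=
  34 * Real.log (n / S.card) + tailTime n (n - S.card)

theorem pullTime_nonneg (hn : 2 ≤ n) (S : Finset (Fin n)) : 0 ≤ pullTime S := by
  have h1 := tailTime_nonneg hn (n - S.card)
  have h2 : 0 ≤ Real.log (n / S.card) := by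
    rcases Nat.eq_zero_or_pos S.card with h | h
    · rw [h]
      simp
    · apply Real.log_nonneg
      have : (0 : ℝ) < S.card := by exact_mod_cast h
      rw [le_div_iff₀ this, one_mul]
      exact card_le_n S
  rw [pullTime]
  linarith

/-- At least `n/16` uninformed nodes: the logarithm, with weight 34, yields the drop. Fewer:
`tailTime` does. The other summand never increases, as informed sets only grow. -/
theorem ev_pullTime_le (hn : 2 ≤ n) {I : Finset (Fin n)} (hI : I.Nonempty) :
    ev (roundLaw Iᶜ I) pullTime ≤ pullTime I - unfinished I := by
  have hn' : (2 : ℝ) ≤ n := by exact_mod_cast hn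
  have hk1 : (1 : ℝ) ≤ I.card := by exact_mod_cast hI.card_pos
  have hsub : ∀ S ∈ (roundLaw Iᶜ I).support, (I.card : ℝ) ≤ S.card := by
    intro S hS
    exact_mod_cast Finset.card_le_card (subset_of_mem_support_roundLaw hS)
  have h1 : ev (roundLaw Iᶜ I) (fun S => Real.log (n / S.card)) ≤ Real.log (n / I.card) := by
    rw [← ev_const (roundLaw Iᶜ I) (Real.log (n / I.card))]
    refine ev_mono_support _ fun S hS => ?_
    have h := hsub S hS
    have h0 : (0 : ℝ) < S.card := by linarith
    exact Real.log_le_log (by positivity)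
      (div_le_div_of_nonneg_left (by linarith) (by linarith) h)
  have h2 : ev (roundLaw Iᶜ I) (fun S => tailTime n (n - S.card)) ≤ tailTime n (n - I.card) := by
    rw [← ev_const (roundLaw Iᶜ I) (tailTime n (n - I.card))]
    exact ev_mono_support _ fun S hS => tailTime_mono hn (by linarith [hsub S hS])
  have h3 : ev (roundLaw Iᶜ I) pullTime =
      34 * ev (roundLaw Iᶜ I) (fun S => Real.log (n / S.card)) +
        ev (roundLaw Iᶜ I) (fun S => tailTime n (n - S.card)) := by
    unfold pullTime
    rw [ev_add, ev_mul]
  rw [h3, pullTime, unfinished]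
  split_ifs with h
  · linarith
  · have hI1 : (1 : ℝ) ≤ n - I.card := by
      rcases uninformed_dichotomy I with h' | h'
      · exfalso
        apply h
        rw [← Finset.card_eq_iff_eq_univ, Fintype.card_fin]
        exact_mod_cast h'
      · exact h'
    rcases le_total (16 * (n - I.card : ℝ)) n with h' | h'
    · linarith [ev_tailTime_pull_le hn hI1 h']
    · linarith [ev_log_card_pull_le hn hI (by linarith)]

/-! ### Lower potential for the pull phase. -/

/-- A lower bound for the number of pull rounds that lead from few to `x` uninformed nodes. -/
def levelCount (n : ℕ) (x : ℝ) : ℝ := Real.logb 2 (1 + deficit n x / Real.log 2)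

/-- The largest value of `levelCount n`. -/
def maxLevel (n : ℕ) : ℝ := Real.logb 2 (1 + Real.log (n / threshold n) / Real.log 2)

theorem levelCount_nonneg (hn : 2 ≤ n) {x : ℝ} (hx : x ≤ n) : 0 ≤ levelCount n x := by
  apply Real.logb_nonneg (by norm_num)
  have := div_nonneg (deficit_nonneg hn hx) log_two_pos.le
  linarith

theorem levelCount_le_max (hn : 2 ≤ n) {x : ℝ} (hx : x ≤ n) : levelCount n x ≤ maxLevel n := by
  have := div_nonneg (deficit_nonneg hn hx) log_two_pos.le
  have h := div_le_div_of_nonneg_right (deficit_le_max hn x) log_two_pos.le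
  exact Real.logb_le_logb_of_le (by norm_num) (by linarith) (by linarith)

theorem levelCount_of_le_threshold {x : ℝ} (h : x ≤ threshold n) :
    levelCount n x = maxLevel n := by
  rw [levelCount, deficit_of_le_threshold h, maxLevel]

theorem maxLevel_nonneg (hn : 2 ≤ n) : 0 ≤ maxLevel n := by
  rw [← levelCount_of_le_threshold (le_refl (threshold n))]
  exact levelCount_nonneg hn (threshold_le hn)

/-- The deficit at `x` is at most `log 2` plus twice that at `u`; the shift by 1 inside `levelCount`
turns this into an exact doubling. -/
theorem levelCount_le_add_one (hn : 2 ≤ n) {u x : ℝ} (hu : threshold n ≤ u) (hun : u ≤ n)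
    (hx : u ^ 2 / (2 * n) ≤ x) (hxn : x ≤ n) : levelCount n x ≤ levelCount n u + 1 := by
  have hn' : (2 : ℝ) ≤ n := by exact_mod_cast hn
  have hu0 : 0 < u := (threshold_pos hn).trans_le hu
  have hl2 := log_two_pos
  have h1 := deficit_le_log_div hn (by positivity) hx
  have h2 : (n : ℝ) / (u ^ 2 / (2 * n)) = 2 * (n / u) ^ 2 := by
    field_simp
  rw [h2, Real.log_mul (by norm_num) (by positivity), Real.log_pow] at h1
  have h3 := deficit_of_threshold_le hu
  have h4 := div_nonneg (deficit_nonneg hn hxn) hl2.le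
  have h5 := div_nonneg (deficit_nonneg hn hun) hl2.le
  have h6 : 1 + deficit n x / Real.log 2 ≤ (1 + deficit n u / Real.log 2) * 2 := by
    have h7 : deficit n x / Real.log 2 ≤ (Real.log 2 + 2 * deficit n u) / Real.log 2 := by
      apply div_le_div_of_nonneg_right _ hl2.le
      rw [h3]
      push_cast at h1
      exact h1
    have h8 : (Real.log 2 + 2 * deficit n u) / Real.log 2 = 1 + deficit n u / Real.log 2 * 2 := by
      field_simp
    linarith
  calc levelCount n x ≤ Real.logb 2 ((1 + deficit n u / Real.log 2) * 2) :=
        Real.logb_le_logb_of_le (by norm_num) (by linarith) h6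
    _ = levelCount n u + 1 := by
        rw [Real.logb_mul (by linarith) (by norm_num), Real.logb_self_eq_one (by norm_num)]
        rfl

/-- Below the threshold the level is already maximal. Above it, the mean uninformed count is at
least `u^2/n`; falling below half of this is charged to the variance, at a cost of order `n^2/u^3 ≤
threshold n / n`. -/
theorem ev_levelCount_pull_le (hn : 2 ≤ n) (I : Finset (Fin n)) :
    ev (roundLaw Iᶜ I) (fun S => levelCount n (n - S.card)) ≤
      levelCount n (n - I.card) + (1 + 4 * maxLevel n * (threshold n / n)) * unfinished I := by
  have hn' : (2 : ℝ) ≤ n := by exact_mod_cast hn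
  have hM := threshold_pos hn
  have hmax := maxLevel_nonneg hn
  have hk := card_le_n I
  have hk0 : (0 : ℝ) ≤ I.card := by positivity
  have hun0 : 0 ≤ unfinished I := by
    unfold unfinished
    split_ifs <;> norm_num
  have hcoef : 0 ≤ (1 + 4 * maxLevel n * (threshold n / n)) * unfinished I := by positivity
  rcases le_or_gt (n - (I.card : ℝ)) (threshold n) with hu | hu
  · rw [levelCount_of_le_threshold hu]
    have h1 : ev (roundLaw Iᶜ I) (fun S => levelCount n (n - S.card)) ≤ maxLevel n := by
      rw [← ev_const (roundLaw Iᶜ I) (maxLevel n)]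
      refine ev_mono _ fun S => levelCount_le_max hn ?_
      have : (0 : ℝ) ≤ S.card := by positivity
      linarith
    linarith
  · have h1 : unfinished I = 1 := by
      rw [unfinished, if_neg]
      rintro rfl
      rw [Finset.card_univ, Fintype.card_fin, sub_self] at hu
      linarith
    have hq := busyProb_le hn I
    have hvar := variance_busyCount_le I
    rw [ev_roundLaw, h1, mul_one]
    set u : ℝ := n - (I.card : ℝ) with hudef
    have hu0 : 0 < u := hM.trans hu
    have hpt : ∀ a ∈ (acceptLaw Iᶜ).support, levelCount n (n - (exchange I a).card) ≤
        (levelCount n u + 1) + maxLevel n * (4 * n ^ 2 / u ^ 4) *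
          (busyCount I a - I.card * busyProb I) ^ 2 := by
      intro a ha
      have hcard : ((exchange I a).card : ℝ) = I.card + busyCount I a := card_exchange_pull ha
      have hcn : (n : ℝ) - (exchange I a).card ≤ n := by
        have : (0 : ℝ) ≤ (exchange I a).card := by positivity
        linarith
      have h2 : (n : ℝ) - (exchange I a).card = u - busyCount I a := by
        rw [hcard, hudef]
        ring
      rcases le_or_gt (u ^ 2 / (2 * n)) ((n : ℝ) - (exchange I a).card) with h3 | h3
      · have h4 := levelCount_le_add_one hn hu.le (by linarith) h3 hcn
        have h5 : 0 ≤ maxLevel n * (4 * n ^ 2 / u ^ 4) *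
          (busyCount I a - I.card * busyProb I) ^ 2 := by positivity
        linarith
      · rw [h2] at h3
        have h4 : (I.card : ℝ) * busyProb I ≤ u - u ^ 2 / n := by
          calc (I.card : ℝ) * busyProb I ≤ I.card * (u / n) :=
                mul_le_mul_of_nonneg_left hq hk0
            _ = u - u ^ 2 / n := by
                have : (I.card : ℝ) = n - u := by rw [hudef]; ring
                rw [this]
                field_simp
        have h5 : u ^ 2 / n = 2 * (u ^ 2 / (2 * n)) := by
          field_simp
        have h6 : u ^ 2 / (2 * n) ≤ busyCount I a - I.card * busyProb I := by linarith
        have h7 : (u ^ 2 / (2 * n)) ^ 2 ≤ (busyCount I a - I.card * busyProb I) ^ 2 :=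
          pow_le_pow_left₀ (by positivity) h6 2
        have h8 : maxLevel n ≤ maxLevel n * (4 * n ^ 2 / u ^ 4) *
            (busyCount I a - I.card * busyProb I) ^ 2 := by
          calc maxLevel n = maxLevel n * (4 * n ^ 2 / u ^ 4) * (u ^ 2 / (2 * n)) ^ 2 := by
                field_simp
                norm_num
            _ ≤ _ := mul_le_mul_of_nonneg_left h7 (by positivity)
        have h9 := levelCount_le_max hn hcn
        have h10 : 0 ≤ levelCount n u := levelCount_nonneg hn (by linarith)
        linarith
    refine (ev_mono_support _ hpt).trans ?_
    rw [ev_add, ev_const, ev_mul]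
    have h2 : maxLevel n * (4 * n ^ 2 / u ^ 4) * ev (acceptLaw Iᶜ)
        (fun a => (busyCount I a - I.card * busyProb I) ^ 2) ≤
          4 * maxLevel n * (threshold n / n) := by
      calc _ ≤ maxLevel n * (4 * n ^ 2 / u ^ 4) * u := by
            refine mul_le_mul_of_nonneg_left (hvar.trans ?_) (by positivity)
            calc (I.card : ℝ) * busyProb I ≤ n * (u / n) :=
                  mul_le_mul hk hq (busyProb_nonneg hn I) (by linarith)
              _ = u := by field_simp
        _ = 4 * maxLevel n * (n ^ 2 / u ^ 3) := by
            field_simp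
        _ ≤ 4 * maxLevel n * (n ^ 2 / threshold n ^ 3) := by
            refine mul_le_mul_of_nonneg_left ?_ (by positivity)
            exact div_le_div_of_nonneg_left (by positivity) (by positivity)
              (pow_le_pow_left₀ hM.le hu.le 3)
        _ = 4 * maxLevel n * (threshold n / n) := by
            congr 1
            rw [div_eq_div_iff (by positivity) (by positivity)]
            have := threshold_pow_four n
            linear_combination -this
    linarith


/-! ### Summing over the push-pull phase. -/

theorem ev_informedLaw_succ_of_lt {R t : ℕ} (h : t < R) (v : Fin n) (f : Finset (Fin n) → ℝ) :
    ev (informedLaw n R v (t + 1)) f =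
      ev (informedLaw n R v t) fun I => ev (roundLaw Finset.univ I) f := by
  rw [informedLaw, ev_bind]
  simp only [callers, if_pos h]

theorem ev_informedLaw_succ_of_le {R t : ℕ} (h : R ≤ t) (v : Fin n) (f : Finset (Fin n) → ℝ) :
    ev (informedLaw n R v (t + 1)) f =
      ev (informedLaw n R v t) fun I => ev (roundLaw Iᶜ I) f := by
  rw [informedLaw, ev_bind]
  simp only [callers, if_neg (not_lt.2 h)]

theorem nonempty_of_mem_support {R t : ℕ} {v : Fin n} {I : Finset (Fin n)}
    (h : I ∈ (informedLaw n R v t).support) : I.Nonempty := by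
  induction t generalizing I with
  | zero =>
    rw [informedLaw, PMF.mem_support_pure_iff] at h
    rw [h]
    exact Finset.singleton_nonempty v
  | succ t ih =>
    rw [informedLaw, PMF.mem_support_bind_iff] at h
    obtain ⟨J, hJ, hI⟩ := h
    exact (ih hJ).mono (subset_of_mem_support_roundLaw hI)

/-- The mean number of informed nodes after `t` rounds. -/
def meanInformed (n R : ℕ) (v : Fin n) (t : ℕ) : ℝ :=
  ev (informedLaw n R v t) fun I => (I.card : ℝ)

/-- The probability that some node is uninformed after `t` rounds. -/
def unfinishedProb (n R : ℕ) (v : Fin n) (t : ℕ) : ℝ := ev (informedLaw n R v t) unfinished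

theorem meanInformed_nonneg (R : ℕ) (v : Fin n) (t : ℕ) : 0 ≤ meanInformed n R v t :=
  ev_nonneg _ fun I => by positivity

theorem meanInformed_le (hn : 2 ≤ n) {R t : ℕ} (ht : t ≤ R) (v : Fin n) :
    meanInformed n R v t ≤ (growth * Real.exp (1 / n)) ^ t := by
  have hn' : (2 : ℝ) ≤ n := by exact_mod_cast hn
  induction t with
  | zero => simp [meanInformed, informedLaw, ev_pure]
  | succ t ih =>
    have h1 : meanInformed n R v (t + 1) ≤ (3 - 2 * idleProb n) * meanInformed n R v t := by
      rw [meanInformed, ev_informedLaw_succ_of_lt (by omega), meanInformed, ← ev_mul]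
      exact ev_mono _ fun I => ev_card_pushPull_le hn I
    have h2 := le_idleProb hn
    have h3 := two_le_growth
    -- The excess `2/n` over `growth` fits into `exp (1/n)` because `growth ≥ 2`; over the whole
    -- phase these factors amount to at most `exp 2`.
    have h4 : 3 - 2 * idleProb n ≤ growth * Real.exp (1 / n) := by
      have h5 := Real.add_one_le_exp (1 / n : ℝ)
      have h6 : (0 : ℝ) ≤ 1 / n := by positivity
      have h7 := growth_eq
      nlinarith
    have h5 : 0 ≤ growth * Real.exp (1 / n) := by positivity
    calc _ ≤ (3 - 2 * idleProb n) * meanInformed n R v t := h1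
      _ ≤ growth * Real.exp (1 / n) * meanInformed n R v t :=
          mul_le_mul_of_nonneg_right h4 (meanInformed_nonneg R v t)
      _ ≤ growth * Real.exp (1 / n) * (growth * Real.exp (1 / n)) ^ t :=
          mul_le_mul_of_nonneg_left (ih (by omega)) h5
      _ = _ := by rw [pow_succ, mul_comm]

theorem sum_growth_pow_le (R : ℕ) : ∑ t ∈ Finset.range R, growth ^ t ≤ growth ^ R := by
  have h := two_le_growth
  induction R with
  | zero => simp
  | succ R ih =>
    rw [Finset.sum_range_succ, pow_succ]
    have : 0 ≤ growth ^ R := by positivity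
    nlinarith

/-- The transition time. -/
def transitionTime (n : ℕ) : ℕ := ⌈Real.logb growth n⌉₊

theorem one_lt_growth : 1 < growth := by linarith [two_le_growth]

theorem logb_growth_nonneg (hn : 2 ≤ n) : 0 ≤ Real.logb growth n := by
  have hn' : (2 : ℝ) ≤ n := by exact_mod_cast hn
  exact Real.logb_nonneg one_lt_growth (by linarith)

theorem le_transitionTime (n : ℕ) : Real.logb growth n ≤ transitionTime n := Nat.le_ceil _

theorem transitionTime_le (hn : 2 ≤ n) : (transitionTime n : ℝ) ≤ Real.logb growth n + 1 :=
  (Nat.ceil_lt_add_one (logb_growth_nonneg hn)).le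

theorem growth_pow_transitionTime_le (hn : 2 ≤ n) : growth ^ transitionTime n ≤ 3 * n := by
  have hn' : (2 : ℝ) ≤ n := by exact_mod_cast hn
  have h0 := one_lt_growth
  calc growth ^ transitionTime n = growth ^ (transitionTime n : ℝ) := (Real.rpow_natCast _ _).symm
    _ ≤ growth ^ (Real.logb growth n + 1) :=
        Real.rpow_le_rpow_of_exponent_le h0.le (transitionTime_le hn)
    _ = n * growth := by
        rw [Real.rpow_add (by linarith), Real.rpow_one, Real.rpow_logb (by linarith) h0.ne'
          (by linarith)]
    _ ≤ 3 * n := by nlinarith [growth_le_three]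

theorem transitionTime_div_le (hn : 2 ≤ n) : (transitionTime n : ℝ) / n ≤ 2 := by
  have hn' : (2 : ℝ) ≤ n := by exact_mod_cast hn
  have h0 := one_lt_growth
  have h1 := transitionTime_le hn
  have h2 : Real.logb growth n ≤ n := by
    rw [Real.logb_le_iff_le_rpow h0 (by linarith), Real.rpow_natCast]
    have h3 : (n : ℝ) ≤ 2 ^ n := by exact_mod_cast Nat.lt_two_pow_self.le
    exact h3.trans (pow_le_pow_left₀ (by norm_num) two_le_growth n)
  rw [div_le_iff₀ (by linarith)]
  linarith

theorem sum_meanInformed_le (hn : 2 ≤ n) (v : Fin n) :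
    ∑ t ∈ Finset.range (transitionTime n), meanInformed n (transitionTime n) v t / n ≤
      3 * Real.exp 2 := by
  have hn' : (2 : ℝ) ≤ n := by exact_mod_cast hn
  have hg := two_le_growth
  have h1 : ∀ t ∈ Finset.range (transitionTime n),
      meanInformed n (transitionTime n) v t ≤ Real.exp 2 * growth ^ t := by
    intro t ht
    have ht' := Finset.mem_range.1 ht
    refine (meanInformed_le hn ht'.le v).trans ?_
    rw [mul_pow, ← Real.exp_nat_mul, mul_comm]
    refine mul_le_mul_of_nonneg_right (Real.exp_le_exp.2 ?_) (by positivity)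
    refine le_trans ?_ (transitionTime_div_le hn)
    rw [mul_one_div]
    apply div_le_div_of_nonneg_right _ (by linarith)
    exact_mod_cast ht'.le
  rw [← Finset.sum_div, div_le_iff₀ (by linarith)]
  calc _ ≤ ∑ t ∈ Finset.range (transitionTime n), Real.exp 2 * growth ^ t :=
        Finset.sum_le_sum h1
    _ ≤ Real.exp 2 * growth ^ transitionTime n := by
        rw [← Finset.mul_sum]
        exact mul_le_mul_of_nonneg_left (sum_growth_pow_le _) (Real.exp_pos 2).le
    _ ≤ Real.exp 2 * (3 * n) :=
        mul_le_mul_of_nonneg_left (growth_pow_transitionTime_le hn) (Real.exp_pos 2).le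
    _ = 3 * Real.exp 2 * n := by ring

/-- The term `5/2 * (1/n)` is the fixed point of `c ↦ 3/5 * c + 1/n`. -/
theorem ev_inv_card_le (hn : 2 ≤ n) {R t : ℕ} (ht : t ≤ R) (v : Fin n) :
    ev (informedLaw n R v t) (fun I => 1 / (I.card : ℝ)) ≤ (3 / 5) ^ t + 5 / 2 * (1 / n) := by
  have hn' : (2 : ℝ) ≤ n := by exact_mod_cast hn
  induction t with
  | zero =>
    have : (0 : ℝ) ≤ 1 / n := by positivity
    simp only [informedLaw, ev_pure, Finset.card_singleton, pow_zero]
    norm_num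
  | succ t ih =>
    rw [ev_informedLaw_succ_of_lt (by omega)]
    have h1 : ev (informedLaw n R v t)
        (fun I => ev (roundLaw Finset.univ I) fun S => 1 / (S.card : ℝ)) ≤
          ev (informedLaw n R v t) (fun I => 3 / 5 * (1 / (I.card : ℝ)) + 1 / n) :=
      ev_mono_support _ fun I hI => ev_inv_card_pushPull_le hn (nonempty_of_mem_support hI)
    rw [ev_add, ev_const, ev_mul] at h1
    rw [pow_succ]
    have h2 := ih (by omega)
    linarith

theorem sum_ev_inv_card_le (hn : 2 ≤ n) (v : Fin n) :
    ∑ t ∈ Finset.range (transitionTime n),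
      ev (informedLaw n (transitionTime n) v t) (fun I => 1 / (I.card : ℝ)) ≤ 15 / 2 := by
  have hn' : (2 : ℝ) ≤ n := by exact_mod_cast hn
  have h1 : ∀ R : ℕ, ∑ t ∈ Finset.range R, (3 / 5 : ℝ) ^ t ≤ 5 / 2 - 5 / 2 * (3 / 5) ^ R := by
    intro R
    induction R with
    | zero => norm_num
    | succ R ih =>
      rw [Finset.sum_range_succ, pow_succ]
      linarith
  refine (Finset.sum_le_sum fun t ht =>
    ev_inv_card_le hn (Finset.mem_range.1 ht).le v).trans ?_
  rw [Finset.sum_add_distrib, Finset.sum_const, Finset.card_range, nsmul_eq_mul]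
  have h2 := h1 (transitionTime n)
  have h3 := transitionTime_div_le hn
  have h4 : (0 : ℝ) ≤ (3 / 5) ^ transitionTime n := by positivity
  have h5 : (transitionTime n : ℝ) * (5 / 2 * (1 / n)) = 5 / 2 * (transitionTime n / n) := by ring
  rw [h5]
  linarith

theorem le_ev_log_card (hn : 2 ≤ n) {R t : ℕ} (ht : t ≤ R) (v : Fin n) :
    t * Real.log growth - ∑ s ∈ Finset.range t,
      (24 * ev (informedLaw n R v s) (fun I => 1 / (I.card : ℝ)) +
        63 * (meanInformed n R v s / n)) ≤
      ev (informedLaw n R v t) (fun I => Real.log I.card) := by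
  induction t with
  | zero => simp [informedLaw, ev_pure]
  | succ t ih =>
    rw [ev_informedLaw_succ_of_lt (by omega), Finset.sum_range_succ]
    have h1 : ev (informedLaw n R v t) (fun I => Real.log I.card + Real.log growth -
        (24 * (1 / (I.card : ℝ)) + 63 * (I.card / n))) ≤ ev (informedLaw n R v t)
          (fun I => ev (roundLaw Finset.univ I) fun S => Real.log S.card) :=
      ev_mono_support _ fun I hI => le_ev_log_card_pushPull hn (nonempty_of_mem_support hI)
    rw [ev_sub, ev_add, ev_const, ev_add, ev_mul, ev_mul, ev_div] at h1
    have h2 := ih (by omega)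
    rw [meanInformed]
    push_cast
    linarith

/-- A bound for the mean logarithmic distance to full information after the push-pull phase. -/
def logGap : ℝ := 180 + 189 * Real.exp 2

theorem ev_log_div_card_le (hn : 2 ≤ n) (v : Fin n) :
    ev (informedLaw n (transitionTime n) v (transitionTime n))
      (fun I => Real.log (n / I.card)) ≤ logGap := by
  have hn' : (2 : ℝ) ≤ n := by exact_mod_cast hn
  have h1 : ev (informedLaw n (transitionTime n) v (transitionTime n))
      (fun I => Real.log (n / I.card)) =
        Real.log n - ev (informedLaw n (transitionTime n) v (transitionTime n))
          (fun I => Real.log I.card) := by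
    rw [← ev_const (informedLaw n (transitionTime n) v (transitionTime n)) (Real.log n), ← ev_sub]
    refine ev_congr_support _ fun I hI => ?_
    have : (0 : ℝ) < I.card := by exact_mod_cast (nonempty_of_mem_support hI).card_pos
    rw [Real.log_div (by linarith) this.ne']
  have h2 := le_ev_log_card hn (le_refl (transitionTime n)) v
  rw [Finset.sum_add_distrib, ← Finset.mul_sum, ← Finset.mul_sum] at h2
  have h3 := sum_meanInformed_le hn v
  have h4 := sum_ev_inv_card_le hn v
  have h5 : Real.log n ≤ transitionTime n * Real.log growth := by
    have h6 := le_transitionTime n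
    rwa [Real.logb, div_le_iff₀ (Real.log_pos one_lt_growth)] at h6
  rw [h1, logGap]
  linarith

/-! ### Upper bound for the expected time. -/

theorem unfinished_nonneg (I : Finset (Fin n)) : 0 ≤ unfinished I := by
  unfold unfinished; split_ifs <;> norm_num

theorem unfinished_le_one (I : Finset (Fin n)) : unfinished I ≤ 1 := by
  unfold unfinished; split_ifs <;> norm_num

theorem unfinishedProb_nonneg (R : ℕ) (v : Fin n) (t : ℕ) : 0 ≤ unfinishedProb n R v t :=
  ev_nonneg _ unfinished_nonneg

theorem unfinishedProb_le_one (R : ℕ) (v : Fin n) (t : ℕ) : unfinishedProb n R v t ≤ 1 := by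
  rw [unfinishedProb, ← ev_const (informedLaw n R v t) 1]
  exact ev_mono _ unfinished_le_one

theorem le_unfinishedProb (hn : 2 ≤ n) (R : ℕ) (v : Fin n) (t : ℕ) :
    1 - meanInformed n R v t / n ≤ unfinishedProb n R v t := by
  have hn' : (2 : ℝ) ≤ n := by exact_mod_cast hn
  rw [unfinishedProb, meanInformed, ← ev_const (informedLaw n R v t) 1, ← ev_div, ← ev_sub]
  refine ev_mono _ fun I => ?_
  rw [unfinished]
  split_ifs with h
  · rw [h, Finset.card_univ, Fintype.card_fin, div_self (by linarith)]
    norm_num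
  · have : (0 : ℝ) ≤ I.card / n := by positivity
    linarith

/-- Telescoping of the expected drop of `pullTime`. -/
theorem sum_unfinishedProb_pull_le (hn : 2 ≤ n) (R : ℕ) (v : Fin n) (J : ℕ) :
    ∑ j ∈ Finset.range J, unfinishedProb n R v (R + j) +
      ev (informedLaw n R v (R + J)) pullTime ≤ ev (informedLaw n R v R) pullTime := by
  induction J with
  | zero => simp
  | succ J ih =>
    have h1 : ev (informedLaw n R v (R + J + 1)) pullTime ≤
        ev (informedLaw n R v (R + J)) (fun I => pullTime I - unfinished I) := by
      rw [ev_informedLaw_succ_of_le (by omega)]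
      exact ev_mono_support _ fun I hI => ev_pullTime_le hn (nonempty_of_mem_support hI)
    rw [ev_sub] at h1
    rw [Finset.sum_range_succ, unfinishedProb]
    rw [← add_assoc]
    linarith

theorem ev_pullTime_transition_le (hn : 2 ≤ n) (v : Fin n) :
    ev (informedLaw n (transitionTime n) v (transitionTime n)) pullTime ≤
      34 * logGap + 6 + Real.logb 2 (Real.log n) := by
  have h1 := ev_log_div_card_le hn v
  have h2 : ev (informedLaw n (transitionTime n) v (transitionTime n)) pullTime ≤
      ev (informedLaw n (transitionTime n) v (transitionTime n))
        (fun I => 34 * Real.log (n / I.card) + (6 + Real.logb 2 (Real.log n))) :=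
    ev_mono _ fun I => add_le_add_right (tailTime_le hn _) _
  rw [ev_add, ev_const, ev_mul] at h2
  linarith

theorem sum_unfinishedProb_le (hn : 2 ≤ n) (v : Fin n) (N : ℕ) :
    ∑ t ∈ Finset.range N, unfinishedProb n (transitionTime n) v t ≤
      transitionTime n + (34 * logGap + 6 + Real.logb 2 (Real.log n)) := by
  set R := transitionTime n
  have h1 : ∑ t ∈ Finset.range N, unfinishedProb n R v t ≤
      ∑ t ∈ Finset.range (R + N), unfinishedProb n R v t :=
    Finset.sum_le_sum_of_subset_of_nonneg (Finset.range_mono (by omega))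
      fun t _ _ => unfinishedProb_nonneg R v t
  have h2 : ∑ t ∈ Finset.range R, unfinishedProb n R v t ≤ R := by
    have := Finset.sum_le_card_nsmul (Finset.range R) (unfinishedProb n R v) 1
      fun t _ => unfinishedProb_le_one R v t
    simpa using this
  have h3 := sum_unfinishedProb_pull_le hn R v N
  have h4 : 0 ≤ ev (informedLaw n R v (R + N)) pullTime := ev_nonneg _ (pullTime_nonneg hn)
  have h5 := ev_pullTime_transition_le hn v
  rw [Finset.sum_range_add] at h1
  linarith

theorem summable_unfinishedProb (hn : 2 ≤ n) (v : Fin n) :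
    Summable (unfinishedProb n (transitionTime n) v) :=
  summable_of_sum_range_le (unfinishedProb_nonneg _ v) (sum_unfinishedProb_le hn v)

theorem tsum_unfinishedProb_le (hn : 2 ≤ n) (v : Fin n) :
    ∑' t, unfinishedProb n (transitionTime n) v t ≤
      transitionTime n + (34 * logGap + 6 + Real.logb 2 (Real.log n)) :=
  Real.tsum_le_of_sum_range_le (unfinishedProb_nonneg _ v) (sum_unfinishedProb_le hn v)

/-! ### Lower bound for the expected time. -/

theorem le_sum_unfinishedProb_push (hn : 2 ≤ n) (v : Fin n) :
    transitionTime n - 3 * Real.exp 2 ≤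
      ∑ t ∈ Finset.range (transitionTime n), unfinishedProb n (transitionTime n) v t := by
  have h1 := sum_meanInformed_le hn v
  have h2 := Finset.sum_le_sum (s := Finset.range (transitionTime n))
    fun t _ => le_unfinishedProb hn (transitionTime n) v t
  rw [Finset.sum_sub_distrib] at h2
  simp only [Finset.sum_const, Finset.card_range, nsmul_eq_mul, mul_one] at h2
  linarith

theorem ev_deficit_le (hn : 4 ≤ n) {R t : ℕ} (ht : t ≤ R) (v : Fin n) :
    ev (informedLaw n R v t) (fun I => deficit n (n - I.card)) ≤
      1 + deficitRate * ∑ s ∈ Finset.range t, meanInformed n R v s / n := by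
  have hn' : (4 : ℝ) ≤ n := by exact_mod_cast hn
  induction t with
  | zero =>
    simp only [informedLaw, ev_pure, Finset.card_singleton, Nat.cast_one, Finset.range_zero,
      Finset.sum_empty, mul_zero, add_zero]
    refine (deficit_le_log_div (by omega) (y := n - 1) (by linarith) le_rfl).trans ?_
    refine (Real.log_le_sub_one_of_pos (div_pos (by linarith) (by linarith))).trans ?_
    rw [sub_le_iff_le_add, div_le_iff₀ (by linarith)]
    linarith
  | succ t ih =>
    rw [ev_informedLaw_succ_of_lt (by omega), Finset.sum_range_succ]
    have h1 : ev (informedLaw n R v t)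
        (fun I => ev (roundLaw Finset.univ I) fun S => deficit n (n - S.card)) ≤
          ev (informedLaw n R v t)
            (fun I => deficit n (n - I.card) + deficitRate * (I.card / n)) :=
      ev_mono_support _ fun I hI => ev_deficit_pushPull_le hn (nonempty_of_mem_support hI)
    rw [ev_add, ev_mul, ev_div] at h1
    have h2 := ih (by omega)
    rw [meanInformed] at *
    linarith

theorem logb_one_add_div_le {x : ℝ} (hx : 0 ≤ x) :
    Real.logb 2 (1 + x / Real.log 2) ≤ 3 * x := by
  have hl := log_two_pos
  have h1 : 0 ≤ x / Real.log 2 := by positivity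
  rw [Real.logb, div_le_iff₀ hl]
  have h2 := Real.log_le_sub_one_of_pos (show 0 < 1 + x / Real.log 2 by linarith)
  have h3 : x / Real.log 2 ≤ 3 * x * Real.log 2 := by
    rw [div_le_iff₀ hl]
    have h4 : 1 ≤ 3 * (Real.log 2 * Real.log 2) := by nlinarith [Real.log_two_gt_d9]
    nlinarith
  linarith

theorem uninformed_le (I : Finset (Fin n)) : (n : ℝ) - I.card ≤ n := by
  have : (0 : ℝ) ≤ I.card := by positivity
  linarith

/-- A bound for the mean level reached at the end of the push-pull phase. -/
def startLevel : ℝ := 3 * (1 + deficitRate * (3 * Real.exp 2))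

theorem deficitRate_nonneg : 0 ≤ deficitRate := by
  have h1 : 0 ≤ Real.log (4 * Real.exp 4) := by
    apply Real.log_nonneg
    have := Real.one_le_exp (show (0 : ℝ) ≤ 4 by norm_num)
    linarith
  have := Real.exp_pos 8
  rw [deficitRate]
  linarith

theorem startLevel_nonneg : 0 ≤ startLevel := by
  have h1 := deficitRate_nonneg
  have h2 := Real.exp_pos 2
  rw [startLevel]
  positivity

theorem ev_levelCount_transition_le (hn : 4 ≤ n) (v : Fin n) :
    ev (informedLaw n (transitionTime n) v (transitionTime n))
      (fun I => levelCount n (n - I.card)) ≤ startLevel := by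
  have hn2 : 2 ≤ n := by omega
  have h1 := ev_deficit_le hn (le_refl (transitionTime n)) v
  have h2 := sum_meanInformed_le hn2 v
  have h3 : ev (informedLaw n (transitionTime n) v (transitionTime n))
      (fun I => levelCount n (n - I.card)) ≤
        ev (informedLaw n (transitionTime n) v (transitionTime n))
          (fun I => 3 * deficit n (n - I.card)) :=
    ev_mono _ fun I => logb_one_add_div_le (deficit_nonneg hn2 (uninformed_le I))
  rw [ev_mul] at h3
  have h4 := mul_le_mul_of_nonneg_left h2 deficitRate_nonneg
  rw [startLevel]
  linarith

theorem ev_levelCount_le (hn : 2 ≤ n) (R : ℕ) (v : Fin n) (J : ℕ) :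
    ev (informedLaw n R v (R + J)) (fun I => levelCount n (n - I.card)) ≤
      ev (informedLaw n R v R) (fun I => levelCount n (n - I.card)) +
        (1 + 4 * maxLevel n * (threshold n / n)) *
          ∑ j ∈ Finset.range J, unfinishedProb n R v (R + j) := by
  induction J with
  | zero => simp
  | succ J ih =>
    have h1 : ev (informedLaw n R v (R + J + 1)) (fun I => levelCount n (n - I.card)) ≤
        ev (informedLaw n R v (R + J)) (fun I => levelCount n (n - I.card) +
          (1 + 4 * maxLevel n * (threshold n / n)) * unfinished I) := by
      rw [ev_informedLaw_succ_of_le (by omega)]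
      exact ev_mono _ fun I => ev_levelCount_pull_le hn I
    rw [ev_add, ev_mul] at h1
    rw [Finset.sum_range_succ, mul_add, unfinishedProb, ← add_assoc]
    linarith

theorem le_ev_levelCount (hn : 2 ≤ n) (R : ℕ) (v : Fin n) (t : ℕ) :
    maxLevel n * (1 - unfinishedProb n R v t) ≤
      ev (informedLaw n R v t) (fun I => levelCount n (n - I.card)) := by
  rw [unfinishedProb, ← ev_const (informedLaw n R v t) 1, ← ev_sub, ← ev_mul]
  refine ev_mono _ fun I => ?_
  rw [unfinished]
  split_ifs with h
  · rw [h, Finset.card_univ, Fintype.card_fin, sub_self,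
      levelCount_of_le_threshold (threshold_pos hn).le]
    linarith
  · rw [sub_self, mul_zero]
    exact levelCount_nonneg hn (uninformed_le I)

/-- Full information forces the maximal level, and summability makes the unfinished probability tend
to zero, so the bound after `J` pull rounds passes to the limit. -/
theorem maxLevel_le_tsum (hn : 4 ≤ n) (v : Fin n) :
    maxLevel n ≤ startLevel + (1 + 4 * maxLevel n * (threshold n / n)) *
      ∑' j, unfinishedProb n (transitionTime n) v (transitionTime n + j) := by
  have hn2 : 2 ≤ n := by omega
  set R := transitionTime n with hR
  have hs := summable_unfinishedProb hn2 v
  rw [← hR] at hs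
  have hs' : Summable fun j => unfinishedProb n R v (R + j) := by
    have := (summable_nat_add_iff R).2 hs
    simpa only [add_comm] using this
  have hcoef : 0 ≤ 1 + 4 * maxLevel n * (threshold n / n) := by
    have h1 := maxLevel_nonneg hn2
    have h2 := threshold_pos hn2
    positivity
  have h1 : ∀ J, maxLevel n * (1 - unfinishedProb n R v (R + J)) ≤ startLevel +
      (1 + 4 * maxLevel n * (threshold n / n)) * ∑' j, unfinishedProb n R v (R + j) := by
    intro J
    have h2 := le_ev_levelCount hn2 R v (R + J)
    have h3 := ev_levelCount_le hn2 R v J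
    have h4 := ev_levelCount_transition_le hn v
    have h5 := hs'.sum_le_tsum (Finset.range J) fun j _ => unfinishedProb_nonneg R v (R + j)
    have h6 := mul_le_mul_of_nonneg_left h5 hcoef
    linarith
  have hlim : Filter.Tendsto (fun J => maxLevel n * (1 - unfinishedProb n R v (R + J)))
      Filter.atTop (nhds (maxLevel n * (1 - 0))) :=
    (hs'.tendsto_atTop_zero.const_sub 1).const_mul _
  rw [sub_zero, mul_one] at hlim
  exact le_of_tendsto' hlim h1

theorem log_div_threshold (hn : 2 ≤ n) : Real.log (n / threshold n) = Real.log n / 4 := by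
  have hn' : (2 : ℝ) ≤ n := by exact_mod_cast hn
  rw [Real.log_div (by linarith) (threshold_pos hn).ne', threshold, Real.log_rpow (by linarith)]
  ring

theorem le_maxLevel (hn : 2 ≤ n) : Real.logb 2 (Real.log n) - 2 ≤ maxLevel n := by
  have hn' : (2 : ℝ) ≤ n := by exact_mod_cast hn
  have hln : 0 < Real.log n := Real.log_pos (by linarith)
  have h1 : Real.logb 2 (Real.log n) - 2 = Real.logb 2 (Real.log n / 4) := by
    rw [Real.logb_div hln.ne' (by norm_num), show (4 : ℝ) = 2 ^ (2 : ℝ) by norm_num,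
      Real.logb_rpow (by norm_num) (by norm_num)]
  rw [h1, maxLevel, log_div_threshold hn]
  apply Real.logb_le_logb_of_le (by norm_num) (by positivity)
  have h2 : Real.log n / 4 ≤ Real.log n / 4 / Real.log 2 := by
    rw [le_div_iff₀ log_two_pos]
    have := Real.log_two_lt_d9
    nlinarith
  linarith

/-- The relative error per pull round times the number of rounds of interest is bounded, `maxLevel`
being only doubly logarithmic. -/
theorem maxLevel_sq_mul_le (hn : 2 ≤ n) : maxLevel n ^ 2 * (threshold n / n) ≤ 36 := by
  have hn' : (2 : ℝ) ≤ n := by exact_mod_cast hn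
  have hM := threshold_pos hn
  have hz : 1 ≤ n / threshold n := by
    rw [le_div_iff₀ hM, one_mul]
    exact threshold_le hn
  have hL := Real.log_nonneg hz
  have h1 : maxLevel n ≤ 3 * Real.log (n / threshold n) := logb_one_add_div_le hL
  have h2 : threshold n / n = (n / threshold n)⁻¹ := by rw [inv_div]
  rw [h2]
  set z := (n : ℝ) / threshold n
  have h3 : Real.log z ≤ 2 * √z := by
    have h4 : Real.log z = 2 * Real.log √z := by
      rw [Real.log_sqrt (by linarith)]
      ring
    rw [h4]
    linarith [Real.log_le_self (Real.sqrt_nonneg z)]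
  have h4 : maxLevel n ≤ 6 * √z := by linarith
  have h5 : maxLevel n ^ 2 ≤ (6 * √z) ^ 2 := pow_le_pow_left₀ (maxLevel_nonneg hn) h4 2
  rw [mul_pow, Real.sq_sqrt (by linarith)] at h5
  rw [← div_eq_mul_inv, div_le_iff₀ (by linarith)]
  linarith

theorem le_tsum_unfinishedProb_pull (hn : 4 ≤ n) (v : Fin n) :
    Real.logb 2 (Real.log n) - (146 + startLevel) ≤
      ∑' j, unfinishedProb n (transitionTime n) v (transitionTime n + j) := by
  have hn2 : 2 ≤ n := by omega
  have h1 := maxLevel_le_tsum hn v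
  have h2 := le_maxLevel hn2
  have h3 := maxLevel_sq_mul_le hn2
  have h4 := maxLevel_nonneg hn2
  have h5 := startLevel_nonneg
  have h6 : 0 ≤ threshold n / n := div_nonneg (threshold_pos hn2).le (by positivity)
  set s := ∑' j, unfinishedProb n (transitionTime n) v (transitionTime n + j)
  -- Only `s ≤ maxLevel n` needs work; the accumulated error is then at most `4 * 36 = 144`, and 2
  -- more come from `le_maxLevel`.
  rcases le_total (maxLevel n) s with h | h
  · linarith
  · have h7 : 4 * maxLevel n * (threshold n / n) * s ≤
        4 * maxLevel n * (threshold n / n) * maxLevel n :=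
      mul_le_mul_of_nonneg_left h (by positivity)
    nlinarith

theorem le_tsum_unfinishedProb (hn : 2 ≤ n) (v : Fin n) :
    transitionTime n + Real.logb 2 (Real.log n) - (3 * Real.exp 2 + 146 + startLevel) ≤
      ∑' t, unfinishedProb n (transitionTime n) v t := by
  have h1 := le_sum_unfinishedProb_push hn v
  have hs := summable_unfinishedProb hn v
  have h2 := hs.sum_add_tsum_nat_add (transitionTime n)
  have h3 := startLevel_nonneg
  rw [← h2]
  rcases le_or_gt 4 n with h | h
  · have h4 := le_tsum_unfinishedProb_pull h v
    simp only [add_comm (transitionTime n)] at h4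
    linarith
  -- For `n = 2, 3` the deficit estimates do not apply, but the doubly logarithmic term is at most
  -- 1.
  · have h4 : 0 ≤ ∑' j, unfinishedProb n (transitionTime n) v (j + transitionTime n) :=
      tsum_nonneg fun j => unfinishedProb_nonneg _ v _
    have h5 : Real.logb 2 (Real.log n) ≤ 1 := by
      have hn' : (2 : ℝ) ≤ n := by exact_mod_cast hn
      have hn3 : (n : ℝ) ≤ 3 := by exact_mod_cast (by omega : n ≤ 3)
      rw [Real.logb_le_iff_le_rpow (by norm_num) (Real.log_pos (by linarith)), Real.rpow_one]
      linarith [Real.log_le_sub_one_of_pos (show (0 : ℝ) < n by linarith)]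
    linarith

theorem expectedSpreadingTime_eq_ofReal (hn : 2 ≤ n) (v : Fin n) :
    expectedSpreadingTime n (transitionTime n) v =
      ENNReal.ofReal (∑' t, unfinishedProb n (transitionTime n) v t) := by
  rw [expectedSpreadingTime_eq_tsum, ENNReal.ofReal_tsum_of_nonneg
    (unfinishedProb_nonneg _ v) (summable_unfinishedProb hn v)]
  rfl

end

end RumorSpreading

theorem mainTheorem12 :
    ∃ C : ℝ, ∀ n : ℕ, 2 ≤ n → ∀ v : Fin n,
      RumorSpreading.expectedSpreadingTime n ⌈Real.logb (3 - 2 / Real.exp 1) n⌉₊ v ≠ ∞ ∧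
      |(RumorSpreading.expectedSpreadingTime n ⌈Real.logb (3 - 2 / Real.exp 1) n⌉₊ v).toReal
        - (Real.logb (3 - 2 / Real.exp 1) n + Real.logb 2 (Real.log n))| ≤ C := by
  -- In the upper constant, `7 = 6 + 1`: the 6 comes from `tailTime_le` and the 1 from rounding up
  -- the transition time.
  refine ⟨max (34 * RumorSpreading.logGap + 7)
    (3 * Real.exp 2 + 146 + RumorSpreading.startLevel), fun n hn v => ?_⟩
  have h1 := RumorSpreading.expectedSpreadingTime_eq_ofReal hn v
  have h2 := RumorSpreading.tsum_unfinishedProb_le hn v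
  have h3 := RumorSpreading.le_tsum_unfinishedProb hn v
  have h4 := RumorSpreading.le_transitionTime n
  have h5 := RumorSpreading.transitionTime_le hn
  have h6 : 0 ≤ ∑' t, RumorSpreading.unfinishedProb n (RumorSpreading.transitionTime n) v t :=
    tsum_nonneg (RumorSpreading.unfinishedProb_nonneg _ v)
  change RumorSpreading.expectedSpreadingTime n (RumorSpreading.transitionTime n) v ≠ ∞ ∧
    |(RumorSpreading.expectedSpreadingTime n (RumorSpreading.transitionTime n) v).toReal
      - (Real.logb RumorSpreading.growth n + Real.logb 2 (Real.log n))| ≤ _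
  rw [h1, ENNReal.toReal_ofReal h6]
  refine ⟨ENNReal.ofReal_ne_top, abs_le.2 ⟨?_, ?_⟩⟩
  · linarith [le_max_right (34 * RumorSpreading.logGap + 7)
      (3 * Real.exp 2 + 146 + RumorSpreading.startLevel)]
  · linarith [le_max_left (34 * RumorSpreading.logGap + 7)
      (3 * Real.exp 2 + 146 + RumorSpreading.startLevel)]
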